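/- An $\omega$-automaton is a finite nondeterministic Büchi automaton. For a finite alphabet $\Sigma$, a relation $S\subseteq(\Sigma^\omega)^n$ is $\omega$-regular if some $\omega$-automaton over the alphabet $\Sigma^n$ accepts exactly the convolutions $i\mapsto(w_1[i],\dots,w_n[i])$ of the tuples $(w_1,\dots,w_n)\in S$. Let $\mathfrak A=(A,(R_i)_{i\in I})$ be a relational structure, where $R_i\subseteq A^{n_i}$. An $\omega$-automatic presentation of $\mathfrak A$ over a finite alphabet $\Sigma$ consists of $\omega$-automata recognising a set $D\subseteq\Sigma^\omega$, a relation ${\approx}\subseteq(\Sigma^\omega)^2$ and relations $S_i\subseteq(\Sigma^\omega)^{n_i}$ ($i\in I$), together with a surjection $f:D\to A$, such that ${\approx}=\{(u,w)\in D^2: f(u)=f(w)\}$ and $S_i=\{(w_1,\dots,w_{n_i})\in D^{n_i}:(f(w_1),\dots,f(w_{n_i}))\in R_i\}$ for every $i\in I$; that is, $\approx$ is a congruence of $(D,(S_i)_{i\in I})$ and $f$ induces an isomorphism $(D,(S_i)_{i\in I})/{\approx}\;\cong\;\mathfrak A$. An automatic presentation over $\Sigma$ is an $\omega$-automatic presentation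 over $\Sigma\cup\{\Box\}$, where $\Box\notin\Sigma$, in which every element of $D$ has the form $w\Box^\omega$ with $w\in\Sigma^*$. The structure $\mathfrak A$ is called $\omega$-automatic (respectively automatic) if it has an $\omega$-automatic (respectively automatic) presentation over some finite alphabet. Then every countable (finite or countably infinite) relational structure is $\omega$-automatic if and only if it is automatic. Moreover, for structures with finitely many relations, presentations can be transformed effectively into one another: there is an algorithm which, given the alphabet and the tuple of automata of any $\omega$-automatic presentation of a countable structure $\mathfrak A$, halts and outputs the alphabet and the automata of an automatic presentation of $\mathfrak A$; and there is an algorithm which does the same in the converse direction. -/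

import Mathlib

universe u v w

/-! ### Büchi automata and synchronised relations on infinite words -/

/-- The nondeterministic automaton `M`, read as a Büchi automaton, accepts the infinite word `x`:
some run on `x` visits accepting states infinitely often. -/
def BuchiAccepts {α : Type u} {σ : Type v} (M : NFA α σ) (x : ℕ → α) : Prop :=
  ∃ ρ : ℕ → σ, ρ 0 ∈ M.start ∧ (∀ i, ρ (i + 1) ∈ M.step (ρ i) (x i)) ∧
    ∃ᶠ i in Filter.atTop, ρ i ∈ M.accept

/-- The convolution of an `n`-tuple of infinite words over `α`, a word over `Fin n → α`. -/
def convolution {α : Type u} {n : ℕ} (x : Fin n → ℕ → α) : ℕ → (Fin n → α) :=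
  fun i j => x j i

/-- The `n`-ary relation on infinite words recognised by an automaton with `n` tapes. -/
def recognizedRel {α : Type u} {σ : Type v} {n : ℕ} (M : NFA (Fin n → α) σ) :
    Set (Fin n → ℕ → α) :=
  {x | BuchiAccepts M (convolution x)}

/-- A relation on infinite words is `ω`-regular if a finite (synchronous, multi-tape,
nondeterministic) Büchi automaton recognises it. -/
def IsOmegaRegular {α : Type u} {n : ℕ} (S : Set (Fin n → ℕ → α)) : Prop :=
  ∃ (σ : Type) (_ : Finite σ) (M : NFA (Fin n → α) σ), recognizedRel M = S

/-- The infinite padding `w □ □ □ …` of a finite word, where `□` is `none`. -/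
def padding {α : Type u} (w : List α) : ℕ → Option α := fun i => w[i]?

/-! ### Automatic presentations -/

/-- `f` exhibits `(D, E, (S i)ᵢ)` as a presentation of the relational structure `(A, (R i)ᵢ)`.
Here `D` is the set of names, given as a unary relation (a set of 1-tuples), `E` is the
equivalence "naming the same element", and each `S i` is the relation on names which is
the full inverse image of `R i`.  The last condition says that `S i` is a relation on `D`, that `E`
is a congruence for it, and that `f` induces an isomorphism of the quotient by `E` with `A`. -/
structure IsPresentation {A : Type u} {ι : Type v} {ar : ι → ℕ} {α : Type w}
    (R : ∀ i, Set (Fin (ar i) → A))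
    (D : Set (Fin 1 → ℕ → α)) (E : Set (Fin 2 → ℕ → α))
    (S : ∀ i, Set (Fin (ar i) → ℕ → α))
    (f : {x : ℕ → α // (fun _ => x) ∈ D} → A) : Prop where
  surjective : Function.Surjective f
  mem_equiv_iff : ∀ x : Fin 2 → ℕ → α, x ∈ E ↔
    ∃ h : ∀ j, (fun _ => x j) ∈ D, f ⟨x 0, h 0⟩ = f ⟨x 1, h 1⟩
  mem_rel_iff : ∀ i, ∀ x : Fin (ar i) → ℕ → α, x ∈ S i ↔
    ∃ h : ∀ j, (fun _ => x j) ∈ D, (fun j => f ⟨x j, h j⟩) ∈ R i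

/-- The relational structure `(A, (R i)ᵢ)` is `ω`-automatic. -/
def IsOmegaAutomatic {A : Type u} {ι : Type v} {ar : ι → ℕ}
    (R : ∀ i, Set (Fin (ar i) → A)) : Prop :=
  ∃ (α : Type) (_ : Finite α) (D : Set (Fin 1 → ℕ → α)) (E : Set (Fin 2 → ℕ → α))
    (S : ∀ i, Set (Fin (ar i) → ℕ → α)) (f : {x : ℕ → α // (fun _ => x) ∈ D} → A),
    IsOmegaRegular D ∧ IsOmegaRegular E ∧ (∀ i, IsOmegaRegular (S i)) ∧
    IsPresentation R D E S f

/-- The relational structure `(A, (R i)ᵢ)` is automatic: it has a presentation by regular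
relations on finite words, that is, by `ω`-regular relations on their paddings. -/
def IsAutomatic {A : Type u} {ι : Type v} {ar : ι → ℕ}
    (R : ∀ i, Set (Fin (ar i) → A)) : Prop :=
  ∃ (α : Type) (_ : Finite α) (D : Set (Fin 1 → ℕ → Option α))
    (E : Set (Fin 2 → ℕ → Option α)) (S : ∀ i, Set (Fin (ar i) → ℕ → Option α))
    (f : {x : ℕ → Option α // (fun _ => x) ∈ D} → A),
    IsOmegaRegular D ∧ IsOmegaRegular E ∧ (∀ i, IsOmegaRegular (S i)) ∧
    (∀ x ∈ D, x 0 ∈ Set.range padding) ∧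
    IsPresentation R D E S f

/-! ### Presentations as finite objects -/

/-- A finite automaton written down as finite data: the number `states` of states, which are
`0, …, states - 1`, lists of initial and of accepting states, and a list of transitions
`(p, label, q)`, the label being the list of the letters (as numbers) on the tapes. -/
structure AutomatonCode where
  states : ℕ
  init : List ℕ
  trans : List (ℕ × List ℕ × ℕ)
  accept : List ℕ

def AutomatonCode.equivProd :
    AutomatonCode ≃ ℕ × List ℕ × List (ℕ × List ℕ × ℕ) × List ℕ where
  toFun c := (c.states, c.init, c.trans, c.accept)
  invFun p := ⟨p.1, p.2.1, p.2.2.1, p.2.2.2⟩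
  left_inv _ := rfl
  right_inv _ := rfl

instance : Primcodable AutomatonCode := Primcodable.ofEquiv _ AutomatonCode.equivProd

/-- The automaton with `n` tapes described by a code, when the letter `a` has the number `e a`. -/
def AutomatonCode.toNFA {α : Type u} (c : AutomatonCode) (e : α → ℕ) (n : ℕ) :
    NFA (Fin n → α) (Fin c.states) where
  start := {q | (q : ℕ) ∈ c.init}
  step p a := {q | ((p : ℕ), List.ofFn (fun j => e (a j)), (q : ℕ)) ∈ c.trans}
  accept := {q | (q : ℕ) ∈ c.accept}

/-- The `n`-ary relation recognised by the coded automaton. -/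
def AutomatonCode.rel {α : Type u} (c : AutomatonCode) (e : α → ℕ) (n : ℕ) :
    Set (Fin n → ℕ → α) :=
  recognizedRel (c.toNFA e n)

/-- A tuple of automata written down as finite data: the size of the alphabet `Σ`, automata for
the domain and for the equivalence, and a finite list of automata for the relations,
each together with the arity of its relation. -/
structure PresentationCode where
  alphabet : ℕ
  dom : AutomatonCode
  equiv : AutomatonCode
  rels : List (ℕ × AutomatonCode)

def PresentationCode.equivProd :
    PresentationCode ≃ ℕ × AutomatonCode × AutomatonCode × List (ℕ × AutomatonCode) where
  toFun c := (c.alphabet, c.dom, c.equiv, c.rels)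
  invFun p := ⟨p.1, p.2.1, p.2.2.1, p.2.2.2⟩
  left_inv _ := rfl
  right_inv _ := rfl

instance : Primcodable PresentationCode := Primcodable.ofEquiv _ PresentationCode.equivProd

/-- The numbers of the letters of `Σ ∪ {□}` where `Σ = Fin k`: `□` is `0`, and `a` is `a + 1`. -/
def paddedLetter (k : ℕ) : Option (Fin k) → ℕ
  | none => 0
  | some a => (a : ℕ) + 1

/-- The code `c` is an `ω`-automatic presentation of the structure `(A, R 0, …, R (m - 1))`, over
the alphabet `Σ = Fin c.alphabet`. -/
def PresentationCode.OmegaPresents (c : PresentationCode) {A : Type u} {m : ℕ} {ar : Fin m → ℕ}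
    (R : ∀ i, Set (Fin (ar i) → A)) : Prop :=
  ∃ B : Fin m → AutomatonCode, c.rels = List.ofFn (fun i => (ar i, B i)) ∧
    ∃ f : {x : ℕ → Fin c.alphabet // (fun _ => x) ∈ c.dom.rel Fin.val 1} → A,
      IsPresentation R (c.dom.rel Fin.val 1) (c.equiv.rel Fin.val 2)
        (fun i => (B i).rel Fin.val (ar i)) f

/-- The code `c` is an automatic presentation of the structure `(A, R 0, …, R (m - 1))`, by
finite words over the alphabet `Σ = Fin c.alphabet`. -/
def PresentationCode.Presents (c : PresentationCode) {A : Type u} {m : ℕ} {ar : Fin m → ℕ}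
    (R : ∀ i, Set (Fin (ar i) → A)) : Prop :=
  ∃ B : Fin m → AutomatonCode, c.rels = List.ofFn (fun i => (ar i, B i)) ∧
    (∀ x ∈ c.dom.rel (paddedLetter c.alphabet) 1, x 0 ∈ Set.range padding) ∧
    ∃ f : {x : ℕ → Option (Fin c.alphabet) //
        (fun _ => x) ∈ c.dom.rel (paddedLetter c.alphabet) 1} → A,
      IsPresentation R (c.dom.rel (paddedLetter c.alphabet) 1)
        (c.equiv.rel (paddedLetter c.alphabet) 2)
        (fun i => (B i).rel (paddedLetter c.alphabet) (ar i)) f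

/-! Padded finite words are infinite words over a larger finite alphabet, so one direction only
renumbers letters. For the other, it is enough that every element of a countable structure has an
ultimately periodic name with a period computable from the number of states of the automaton for
`≈`. A finite word can then stand for its continuation with that period, and a finite automaton
performs the translation by remembering one period of letters (`AutomatonCode.mem_rel_names_iff`).

The periodic names are found among languages in which membership depends only on the classes of the
blocks of a factorisation, under a congruence on finite words with finitely many classes. Büchi
languages are of this kind, and the kind is closed under complement, intersection and projection, so
no automaton is ever complemented. By Ramsey's theorem a nonempty language of this kind contains an
ultimately periodic word whose period is controlled by the number of classes
(`Respects.exists_periodic`).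

Countability enters through `covers_of_class_eq`. If `(a, a)` and `(b, b)` have the same class on
all Ramsey blocks, `a` and `b` can be mixed blockwise along an uncountable chain of sets. Two of the
mixtures must be equivalent, and this forces `a` to be equivalent to a word ultimately equal to `b`.
By pigeonhole there are finitely many words `c i` such that each name is equivalent to a word
ultimately equal to some `c i` (`exists_finite_cover`). The tuples `c` with this property form a
nonempty language of the above kind, so `c` can be chosen ultimately periodic
(`exists_equivalent_periodic`). -/

/-! ### Factors of infinite words -/

/-- The factor of the infinite word `x` at the positions `m, …, n - 1`. -/
def seg {α : Type u} (x : ℕ → α) (m n : ℕ) : List α := (List.range' m (n - m)).map x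

@[simp] theorem length_seg {α : Type u} (x : ℕ → α) (m n : ℕ) : (seg x m n).length = n - m := by
  simp [seg]

theorem seg_append {α : Type u} (x : ℕ → α) {m n k : ℕ} (h : m ≤ n) (h' : n ≤ k) :
    seg x m n ++ seg x n k = seg x m k := by
  obtain ⟨a, rfl⟩ := Nat.exists_eq_add_of_le h
  obtain ⟨b, rfl⟩ := Nat.exists_eq_add_of_le h'
  have h1 : m + a - m = a := by omega
  have h2 : m + a + b - (m + a) = b := by omega
  have h3 : m + a + b - m = a + b := by omega
  simp only [seg, h1, h2, h3, ← List.map_append]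
  rw [← List.range'_append (s := m) (m := a) (n := b) (step := 1), one_mul]

theorem seg_congr {α : Type u} {x y : ℕ → α} {m n : ℕ} (h : ∀ i, m ≤ i → i < n → x i = y i) :
    seg x m n = seg y m n := by
  refine List.map_congr_left fun i hi => ?_
  rw [List.mem_range'_1] at hi
  exact h i hi.1 (by omega)

theorem map_seg {α : Type u} {β : Type v} (f : α → β) (x : ℕ → α) (m n : ℕ) :
    (seg x m n).map f = seg (fun i => f (x i)) m n := by
  simp [seg, Function.comp_def]

theorem getElem_seg {α : Type u} (x : ℕ → α) {m n i : ℕ} (h : i < (seg x m n).length) :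
    (seg x m n)[i] = x (m + i) := by
  simp [seg]

theorem seg_succ_left {α : Type u} (x : ℕ → α) {m n : ℕ} (h : m < n) :
    seg x m n = x m :: seg x (m + 1) n := by
  rw [← seg_append x (Nat.le_succ m) h]
  simp [seg]

theorem seg_self {α : Type u} (x : ℕ → α) (m : ℕ) : seg x m m = [] := by simp [seg]

theorem seg_eq_imp {α : Type u} {x y : ℕ → α} {m n i : ℕ} (h : seg x m n = seg y m n)
    (h1 : m ≤ i) (h2 : i < n) : x i = y i := by
  have h3 : i - m < (seg x m n).length := by simp; omega
  have h4 := getElem_seg x h3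
  have h5 : i - m < (seg y m n).length := by simp; omega
  have h6 := getElem_seg y h5
  rw [show m + (i - m) = i by omega] at h4 h6
  rw [← h4, ← h6]
  congr 1

/-! ### Cutting infinite words into blocks -/

/-- `κ` enumerates increasingly the first positions of the blocks of a factorisation of an
infinite word into nonempty blocks. -/
structure IsCut (κ : ℕ → ℕ) : Prop where
  strictMono : StrictMono κ
  zero : κ 0 = 0

theorem IsCut.exists_block {κ : ℕ → ℕ} (h : IsCut κ) (i : ℕ) : ∃ n, κ n ≤ i ∧ i < κ (n + 1) := by
  have h0 : κ 0 ≤ i := by simp [h.zero]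
  refine ⟨Nat.findGreatest (fun n => κ n ≤ i) i,
    Nat.findGreatest_spec (P := fun n => κ n ≤ i) (Nat.zero_le i) h0, ?_⟩
  by_contra! hc
  have h1 := Nat.le_findGreatest (P := fun n => κ n ≤ i)
    ((h.strictMono.le_apply (x := _)).trans hc) hc
  omega

/-- The number of the block which contains the position `i`. -/
noncomputable def IsCut.block {κ : ℕ → ℕ} (h : IsCut κ) (i : ℕ) : ℕ := (h.exists_block i).choose

theorem IsCut.block_le {κ : ℕ → ℕ} (h : IsCut κ) (i : ℕ) : κ (h.block i) ≤ i :=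
  (h.exists_block i).choose_spec.1

theorem IsCut.lt_block {κ : ℕ → ℕ} (h : IsCut κ) (i : ℕ) : i < κ (h.block i + 1) :=
  (h.exists_block i).choose_spec.2

theorem IsCut.block_eq {κ : ℕ → ℕ} (h : IsCut κ) {i n : ℕ} (h1 : κ n ≤ i) (h2 : i < κ (n + 1)) :
    h.block i = n := by
  have h3 := h.strictMono.lt_iff_lt.1 ((h.block_le i).trans_lt h2)
  have h4 := h.strictMono.lt_iff_lt.1 (h1.trans_lt (h.lt_block i))
  omega

theorem IsCut.lt_succ {κ : ℕ → ℕ} (h : IsCut κ) (n : ℕ) : κ n < κ (n + 1) :=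
  h.strictMono (Nat.lt_succ_self n)

theorem IsCut.exists_seg_eq {α : Type u} {κ : ℕ → ℕ} (h : IsCut κ) (l : ℕ → List α)
    (hl : ∀ n, (l n).length = κ (n + 1) - κ n) :
    ∃ z : ℕ → α, ∀ n, seg z (κ n) (κ (n + 1)) = l n := by
  have hb : ∀ i, i - κ (h.block i) < (l (h.block i)).length := fun i => by
    have := h.block_le i
    have := h.lt_block i
    rw [hl]; omega
  refine ⟨fun i => (l (h.block i))[i - κ (h.block i)]'(hb i), fun n => ?_⟩
  refine List.ext_getElem (by simp [hl]) fun i h1 h2 => ?_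
  rw [getElem_seg]
  have h3 : i < κ (n + 1) - κ n := by simpa using h1
  have h4 : h.block (κ n + i) = n := h.block_eq (by omega) (by omega)
  simp only [h4]
  congr 1
  omega

/-- `Q` is a congruence on finite words, given by its classes. -/
def IsCongr {α : Type u} {T : Type v} (Q : List α → T) : Prop :=
  ∀ a a' b b', Q a = Q a' → Q b = Q b' → Q (a ++ b) = Q (a' ++ b')

/-- Membership in the language `L` depends only on the classes under `Q` of the blocks
of a factorisation. -/
def Respects {α : Type u} {T : Type v} (Q : List α → T) (L : Set (ℕ → α)) : Prop :=
  ∀ (x y : ℕ → α) (κ l : ℕ → ℕ), IsCut κ → IsCut l →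
    (∀ n, Q (seg x (κ n) (κ (n + 1))) = Q (seg y (l n) (l (n + 1)))) → x ∈ L → y ∈ L

/-! ### Closure properties of languages that respect a congruence. -/

theorem Respects.mem_iff {α : Type u} {T : Type v} {Q : List α → T} {L : Set (ℕ → α)}
    (hL : Respects Q L) {x y : ℕ → α} {κ l : ℕ → ℕ} (hκ : IsCut κ) (hl : IsCut l)
    (h : ∀ n, Q (seg x (κ n) (κ (n + 1))) = Q (seg y (l n) (l (n + 1)))) : x ∈ L ↔ y ∈ L :=
  ⟨hL x y κ l hκ hl h, hL y x l κ hl hκ fun n => (h n).symm⟩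

/-- Having blocks of equal classes is a symmetric condition, so complementation is free, with the
same congruence. -/
theorem Respects.compl {α : Type u} {T : Type v} {Q : List α → T} {L : Set (ℕ → α)}
    (hL : Respects Q L) : Respects Q Lᶜ :=
  fun _ _ _ _ hκ hl h hx hy => hx ((hL.mem_iff hκ hl h).2 hy)

theorem Respects.inter {α : Type u} {T : Type v} {T' : Type w} {Q : List α → T} {Q' : List α → T'}
    {L L' : Set (ℕ → α)} (hL : Respects Q L) (hL' : Respects Q' L') :
    Respects (fun l => (Q l, Q' l)) (L ∩ L') :=
  fun x y κ l hκ hl h hx =>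
    ⟨hL x y κ l hκ hl (fun n => (Prod.ext_iff.1 (h n)).1) hx.1,
      hL' x y κ l hκ hl (fun n => (Prod.ext_iff.1 (h n)).2) hx.2⟩

theorem IsCongr.prod {α : Type u} {T : Type v} {T' : Type w} {Q : List α → T} {Q' : List α → T'}
    (h : IsCongr Q) (h' : IsCongr Q') : IsCongr (fun l => (Q l, Q' l)) :=
  fun a a' b b' ha hb => Prod.ext (h a a' b b' (Prod.ext_iff.1 ha).1 (Prod.ext_iff.1 hb).1)
    (h' a a' b b' (Prod.ext_iff.1 ha).2 (Prod.ext_iff.1 hb).2)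

theorem Respects.comap {α β : Type u} {T : Type v} {Q : List α → T} {L : Set (ℕ → α)}
    (hL : Respects Q L) (φ : β → α) :
    Respects (fun l => Q (l.map φ)) {x : ℕ → β | (fun i => φ (x i)) ∈ L} :=
  fun _ _ κ l hκ hl h hx => hL _ _ κ l hκ hl (fun n => by simpa [map_seg] using h n) hx

theorem IsCongr.comap {α β : Type u} {T : Type v} {Q : List α → T} (h : IsCongr Q) (φ : β → α) :
    IsCongr (fun l => Q (l.map φ)) :=
  fun a a' b b' ha hb => by simpa using h _ _ _ _ ha hb

/-- The classes of the words which project to a given word. -/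
def projClasses {α : Type u} {β : Type v} {T : Type w} (Q : List (α × β) → T)
    (l : List β) : Set T :=
  {t | ∃ l', l'.map Prod.snd = l ∧ Q l' = t}

theorem IsCongr.projClasses {α : Type u} {β : Type v} {T : Type w} {Q : List (α × β) → T}
    (h : IsCongr Q) : IsCongr (projClasses Q) := by
  have key : ∀ a a' b b', _root_.projClasses Q a = _root_.projClasses Q a' →
      _root_.projClasses Q b = _root_.projClasses Q b' →
      _root_.projClasses Q (a ++ b) ⊆ _root_.projClasses Q (a' ++ b') := by
    rintro a a' b b' ha hb t ⟨l, hl, rfl⟩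
    obtain ⟨l₁, l₂, rfl, h1, h2⟩ := List.map_eq_append_iff.1 hl
    have h3 : Q l₁ ∈ _root_.projClasses Q a' := ha ▸ ⟨l₁, h1, rfl⟩
    have h4 : Q l₂ ∈ _root_.projClasses Q b' := hb ▸ ⟨l₂, h2, rfl⟩
    obtain ⟨m₁, h5, h6⟩ := h3
    obtain ⟨m₂, h7, h8⟩ := h4
    exact ⟨m₁ ++ m₂, by simp [h5, h7], h _ _ _ _ h6 h8⟩
  exact fun a a' b b' ha hb =>
    Set.Subset.antisymm (key a a' b b' ha hb) (key a' a b' b ha.symm hb.symm)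

/-- Equal projected classes allow a first track to be chosen on each block of the second word with
the class of the corresponding block of the first. The choices on different blocks are independent,
so they glue to one infinite word. -/
theorem Respects.proj {α : Type u} {β : Type v} {T : Type w} {Q : List (α × β) → T}
    {L : Set (ℕ → α × β)} (hL : Respects Q L) :
    Respects (projClasses Q) {y | ∃ x : ℕ → α, (fun i => (x i, y i)) ∈ L} := by
  rintro y y' κ l hκ hl h ⟨x, hx⟩
  have h1 : ∀ n, Q (seg (fun i => (x i, y i)) (κ n) (κ (n + 1))) ∈
      projClasses Q (seg y' (l n) (l (n + 1))) := fun n =>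
    h n ▸ ⟨_, by rw [map_seg], rfl⟩
  choose s hs hs' using h1
  obtain ⟨z, hz⟩ := hl.exists_seg_eq s fun n => by
    have := congrArg List.length (hs n); simpa using this
  have hy : ∀ i, (z i).2 = y' i := fun i => by
    have h2 := hs (hl.block i)
    rw [← hz, map_seg] at h2
    exact seg_eq_imp h2 (hl.block_le i) (hl.lt_block i)
  refine ⟨fun i => (z i).1, ?_⟩
  have h3 : (fun i => ((z i).1, y' i)) = z := funext fun i => by rw [← hy i]
  rw [h3]
  exact hL _ z κ l hκ hl (fun n => by rw [hz, hs']) hx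

/-! ### Ramsey's theorem for pairs of natural numbers -/

/-- Along a nonprincipal ultrafilter each `f m` has a limit colour `g m`, and `g` has a limit colour
`c`. Among the `m` with `g m = c` a sequence can be chosen greedily, since almost every `n` has
colour `c` with all earlier members. -/
theorem exists_strictMono_pairs_monochromatic {C : Type u} [Finite C] (f : ℕ → ℕ → C) :
    ∃ k : ℕ → ℕ, StrictMono k ∧ ∃ c, ∀ i j, i < j → f (k i) (k j) = c := by
  let U : Ultrafilter ℕ := Filter.hyperfilter ℕ
  have hlim : ∀ g : ℕ → C, ∃ c, ∀ᶠ n in (U : Filter ℕ), g n = c := fun g => by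
    exact (Ultrafilter.eventually_exists_iff (f := U) (P := fun c n => g n = c)).1
      (Filter.Eventually.of_forall fun n => ⟨g n, rfl⟩)
  choose g hg using fun m => hlim (f m)
  obtain ⟨c, hc⟩ := hlim g
  obtain ⟨k, h1, h2⟩ := exists_seq_of_forall_finset_exists (fun m => g m = c)
    (fun x y => x < y ∧ f x y = c) fun s hs => by
      have h3 : ∀ᶠ n in (U : Filter ℕ), ∀ x ∈ s, x < n ∧ f x n = c := by
        refine (Filter.eventually_all_finset s).2 fun x hx => ?_
        filter_upwards [hg x, Nat.hyperfilter_le_atTop (Filter.eventually_gt_atTop x)]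
          with n h4 h5
        exact ⟨h5, h4.trans (hs x hx)⟩
      exact (hc.and h3).exists
  exact ⟨k, fun i j hij => (h2 i j hij).1, c, fun i j hij => (h2 i j hij).2⟩

/-! ### Ultimately periodic words -/

/-- Two prefixes of a long word share a class; cutting out what lies between them preserves the
class of the word. -/
theorem IsCongr.exists_short {α : Type u} {T : Type v} [Finite T] {Q : List α → T} (h : IsCongr Q)
    (l : List α) (hl : l ≠ []) : ∃ l', l' ≠ [] ∧ l'.length ≤ Nat.card T ∧ Q l' = Q l := by
  induction hn : l.length using Nat.strong_induction_on generalizing l with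
  | _ n ih =>
    by_cases hle : l.length ≤ Nat.card T
    · exact ⟨l, hl, hle, rfl⟩
    push Not at hle
    have := Fintype.ofFinite T
    -- The prefixes compared have length at least `1`, which keeps the shortened word nonempty.
    obtain ⟨i, j, hij, he⟩ := Fintype.exists_ne_map_eq_of_card_lt
      (fun i : Fin (Nat.card T + 1) => Q (l.take (i + 1))) (by simp)
    wlog hlt : i < j generalizing i j
    · exact this j i hij.symm he.symm (lt_of_le_of_ne (not_lt.1 hlt) hij.symm)
    have hi := i.2
    have hj := j.2
    have hlt' : (i : ℕ) < j := hlt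
    have hq : Q (l.take (i + 1) ++ l.drop (j + 1)) = Q l := by
      rw [h _ _ _ _ he rfl, List.take_append_drop]
    obtain ⟨l', h1, h2, h3⟩ := ih _ (by simp; omega) (l.take (i + 1) ++ l.drop (j + 1))
      (by simp [hl]) rfl
    exact ⟨l', h1, h2, h3.trans hq⟩

/-- A cut has to begin at `0`, so the first Ramsey position is overwritten. Ramsey information is
therefore available only for blocks with index at least `1`. -/
theorem IsCut.of_strictMono {k : ℕ → ℕ} (hk : StrictMono k) :
    IsCut (fun n => if n = 0 then 0 else k n) := by
  refine ⟨strictMono_nat_of_lt_succ fun n => ?_, by simp⟩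
  rcases n with _ | n
  · simpa using (Nat.zero_le _).trans_lt (hk Nat.zero_lt_one)
  · simpa using hk (Nat.lt_succ_self _)

/-- A nonempty language which respects a congruence with finitely many classes contains an
ultimately periodic word of bounded period. -/
theorem Respects.exists_periodic {α : Type u} {T : Type v} [Finite T] {Q : List α → T}
    {L : Set (ℕ → α)} (hQ : IsCongr Q) (hL : Respects Q L) (hne : L.Nonempty) :
    ∃ z ∈ L, ∃ m, ∀ t, m ≤ t → z (t + (Nat.card T).factorial) = z t := by
  obtain ⟨x, hx⟩ := hne
  obtain ⟨k, hk, c, hc⟩ := exists_strictMono_pairs_monochromatic fun m n => Q (seg x m n)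
  obtain ⟨l, hl, hlc, hlQ⟩ := hQ.exists_short (seg x (k 1) (k 2)) (by
    have := hk (show 1 < 2 by norm_num)
    rw [← List.length_pos_iff, length_seg]; omega)
  rw [hc 1 2 (by norm_num)] at hlQ
  have hpos : 0 < l.length := List.length_pos_iff.2 hl
  -- After the initial block every Ramsey block has class `c`, and so has the short word `l`; each
  -- of them can be replaced by a copy of `l`.
  let z : ℕ → α := fun t => if t < k 1 then x t else l[(t - k 1) % l.length]'(Nat.mod_lt _ hpos)
  have hz : ∀ t, k 1 ≤ t → z t = l[(t - k 1) % l.length]'(Nat.mod_lt _ hpos) := fun t ht => by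
    simp [z, not_lt.2 ht]
  refine ⟨z, ?_, k 1, fun t ht => ?_⟩
  · refine hL x z (fun n => if n = 0 then 0 else k n)
      (fun n => if n = 0 then 0 else k 1 + (n - 1) * l.length) (IsCut.of_strictMono hk)
      ⟨strictMono_nat_of_lt_succ fun n => ?_, by simp⟩ (fun n => ?_) hx
    · rcases n with _ | n
      · simpa using (Nat.zero_le _).trans_lt (hk Nat.zero_lt_one)
      · simp [hpos]
    · rcases n with _ | n
      · simp only [zero_add, if_true, one_ne_zero, if_false, Nat.sub_self, zero_mul, add_zero]
        rw [seg_congr (y := z) fun i _ hi => by simp [z, hi]]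
      · simp only [Nat.succ_ne_zero, if_false, Nat.add_sub_cancel]
        rw [hc _ _ (Nat.lt_succ_self _), ← hlQ]
        congr 1
        refine List.ext_getElem (by simp [Nat.succ_mul]; omega) fun i h1 h2 => ?_
        rw [getElem_seg, hz _ (by rw [add_assoc]; exact Nat.le_add_right _ _)]
        congr 1
        rw [show k 1 + n * l.length + i - k 1 = i + l.length * n by rw [mul_comm n]; omega,
          Nat.add_mul_mod_self_left, Nat.mod_eq_of_lt h1]
  · rw [hz _ ht, hz _ (ht.trans (Nat.le_add_right _ _))]
    congr 1
    -- The length of `l` is at most the number of classes, so the factorial is a common period that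
    -- does not depend on `l`.
    obtain ⟨q, hq⟩ := Nat.dvd_factorial hpos hlc
    rw [hq, show t + l.length * q - k 1 = t - k 1 + l.length * q by omega,
      Nat.add_mul_mod_self_left]

/-! ### The classes of finite words for a Büchi automaton -/

/-- A run of `M` on the word leads from `p` to `q`; if `b` is true, it visits an accepting state
before its end. -/
def NFA.Leads {α : Type u} {σ : Type v} (M : NFA α σ) : List α → σ → σ → Bool → Prop
  | [], p, q, b => p = q ∧ b = false
  | a :: l, p, q, b => ∃ r ∈ M.step p a, ∃ b₁ b₂, (b₁ = true → p ∈ M.accept) ∧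
      M.Leads l r q b₂ ∧ b = (b₁ || b₂)

/-- The set of all triples `(p, q, b)` with `M.Leads l p q b`. -/
def NFA.runType {α : Type u} {σ : Type v} (M : NFA α σ) (l : List α) : Set (σ × σ × Bool) :=
  {t | M.Leads l t.1 t.2.1 t.2.2}

theorem NFA.leads_append {α : Type u} {σ : Type v} (M : NFA α σ) (l l' : List α) (p q : σ)
    (b : Bool) : M.Leads (l ++ l') p q b ↔
      ∃ r b₁ b₂, M.Leads l p r b₁ ∧ M.Leads l' r q b₂ ∧ b = (b₁ || b₂) := by
  induction l generalizing p b with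
  | nil =>
    simp only [List.nil_append, NFA.Leads]
    constructor
    · exact fun h => ⟨p, false, b, ⟨rfl, rfl⟩, h, by simp⟩
    · rintro ⟨r, _, b₂, ⟨rfl, rfl⟩, h, rfl⟩
      simpa using h
  | cons a l ih =>
    simp only [List.cons_append, NFA.Leads, ih]
    constructor
    · rintro ⟨r, hr, b₁, _, h1, ⟨s, c₁, c₂, h2, h3, rfl⟩, rfl⟩
      exact ⟨s, b₁ || c₁, c₂, ⟨r, hr, b₁, c₁, h1, h2, rfl⟩, h3, by simp [Bool.or_assoc]⟩
    · rintro ⟨s, _, c₂, ⟨r, hr, b₁, c₁, h1, h2, rfl⟩, h3, rfl⟩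
      exact ⟨r, hr, b₁, c₁ || c₂, h1, ⟨s, c₁, c₂, h2, h3, rfl⟩, by simp [Bool.or_assoc]⟩

theorem NFA.isCongr_runType {α : Type u} {σ : Type v} (M : NFA α σ) : IsCongr M.runType := by
  intro a a' b b' ha hb
  have ha' : ∀ p q c, M.Leads a p q c ↔ M.Leads a' p q c := fun p q c =>
    Set.ext_iff.1 ha (p, q, c)
  have hb' : ∀ p q c, M.Leads b p q c ↔ M.Leads b' p q c := fun p q c =>
    Set.ext_iff.1 hb (p, q, c)
  ext ⟨p, q, c⟩
  simp only [NFA.runType, Set.mem_ofPred_eq, NFA.leads_append, ha', hb']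

theorem NFA.leads_seg_iff {α : Type u} {σ : Type v} (M : NFA α σ) (x : ℕ → α) {m n : ℕ}
    (hmn : m ≤ n) (p q : σ) (b : Bool) :
    M.Leads (seg x m n) p q b ↔ ∃ ρ : ℕ → σ, ρ m = p ∧ ρ n = q ∧
      (∀ i, m ≤ i → i < n → ρ (i + 1) ∈ M.step (ρ i) (x i)) ∧
      (b = true → ∃ i, m ≤ i ∧ i < n ∧ ρ i ∈ M.accept) := by
  obtain ⟨d, rfl⟩ := Nat.exists_eq_add_of_le hmn
  clear hmn
  induction d generalizing m p b with
  | zero =>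
    rw [add_zero, seg_self, NFA.Leads]
    constructor
    · rintro ⟨rfl, rfl⟩
      exact ⟨fun _ => p, rfl, rfl, fun i _ _ => by omega, by simp⟩
    · rintro ⟨ρ, rfl, rfl, -, h⟩
      refine ⟨rfl, ?_⟩
      by_contra hb
      obtain ⟨i, h1, h2, -⟩ := h (by simpa using hb)
      omega
  | succ d ih =>
    rw [seg_succ_left x (by omega), NFA.Leads]
    have ih' := fun p b => ih (m := m + 1) p b
    rw [show m + 1 + d = m + (d + 1) by omega] at ih'
    simp only [ih']
    constructor
    · rintro ⟨_, hr, b₁, b₂, h1, ⟨ρ, rfl, rfl, h2, h3⟩, rfl⟩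
      refine ⟨fun i => if i ≤ m then p else ρ i, by simp, by simp, fun i hi hi' => ?_, fun hb => ?_⟩
      · rcases hi.eq_or_lt with rfl | hlt
        · simpa using hr
        · simpa [not_le.2 hlt, not_le.2 (Nat.lt_succ_of_lt hlt)] using h2 i hlt hi'
      · rcases Bool.or_eq_true_iff.1 hb with hb | hb
        · exact ⟨m, le_rfl, by omega, by simpa using h1 hb⟩
        · obtain ⟨i, h4, h5, h6⟩ := h3 hb
          exact ⟨i, by omega, h5, by simpa [show ¬ i ≤ m by omega] using h6⟩
    · rintro ⟨ρ, rfl, rfl, h2, h3⟩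
      classical
      -- An accepting visit is credited to the tail if the tail contains one, and otherwise to the
      -- first state.
      by_cases hb : b = true ∧ ∃ i, m + 1 ≤ i ∧ i < m + (d + 1) ∧ ρ i ∈ M.accept
      · exact ⟨ρ (m + 1), h2 m le_rfl (by omega), false, true, by simp,
          ⟨ρ, rfl, rfl, fun i hi hi' => h2 i (by omega) hi', fun _ => hb.2⟩, by simp [hb.1]⟩
      · refine ⟨ρ (m + 1), h2 m le_rfl (by omega), b, false, fun hb' => ?_,
          ⟨ρ, rfl, rfl, fun i hi hi' => h2 i (by omega) hi', by simp⟩, by simp⟩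
        obtain ⟨i, h4, h5, h6⟩ := h3 hb'
        rcases h4.eq_or_lt with rfl | hlt
        · exact h6
        · exact absurd ⟨hb', i, hlt, h5, h6⟩ hb

/-- Infinitely many accepting visits amount to infinitely many blocks containing one. The right-hand
side mentions the word only through the run types of its blocks, which gives `NFA.respects_runType`.
-/
theorem NFA.buchiAccepts_iff {α : Type u} {σ : Type v} (M : NFA α σ) (x : ℕ → α) {κ : ℕ → ℕ}
    (hκ : IsCut κ) : BuchiAccepts M x ↔ ∃ (r : ℕ → σ) (b : ℕ → Bool), r 0 ∈ M.start ∧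
      (∀ n, M.Leads (seg x (κ n) (κ (n + 1))) (r n) (r (n + 1)) (b n)) ∧
      ∃ᶠ n in Filter.atTop, b n = true := by
  classical
  constructor
  · rintro ⟨ρ, h0, h1, h2⟩
    refine ⟨fun n => ρ (κ n), fun n => decide (∃ i, κ n ≤ i ∧ i < κ (n + 1) ∧ ρ i ∈ M.accept),
      by simpa [hκ.zero] using h0, fun n => ?_, ?_⟩
    · exact (M.leads_seg_iff x (hκ.lt_succ n).le _ _ _).2
        ⟨ρ, rfl, rfl, fun i _ _ => h1 i, fun h => of_decide_eq_true h⟩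
    · rw [Filter.frequently_atTop] at h2 ⊢
      intro N
      obtain ⟨i, h3, h4⟩ := h2 (κ N)
      refine ⟨hκ.block i, ?_, decide_eq_true ⟨i, hκ.block_le i, hκ.lt_block i, h4⟩⟩
      exact Nat.lt_succ_iff.1 (hκ.strictMono.lt_iff_lt.1 (h3.trans_lt (hκ.lt_block i)))
  · rintro ⟨r, b, h0, h1, h2⟩
    simp only [M.leads_seg_iff x (hκ.lt_succ _).le] at h1
    choose ρ hρ hρ' hs ha using h1
    refine ⟨fun i => ρ (hκ.block i) i, ?_, fun i => ?_, ?_⟩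
    · have : hκ.block 0 = 0 := hκ.block_eq hκ.zero.le (by
        have := hκ.lt_succ 0; omega)
      have h3 := hρ 0
      rw [hκ.zero] at h3
      simpa [this, h3] using h0
    · have h3 := hs (hκ.block i) i (hκ.block_le i) (hκ.lt_block i)
      have h4 := hκ.lt_block i
      rcases (Nat.succ_le_of_lt h4).eq_or_lt with h5 | h5
      · have h6 : hκ.block (i + 1) = hκ.block i + 1 :=
          hκ.block_eq h5.ge (by have := hκ.lt_succ (hκ.block i + 1); omega)
        have h7 := hρ (hκ.block i + 1)
        have h8 := hρ' (hκ.block i)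
        rw [← h5] at h7 h8
        simp only [h6]
        rw [h7, ← h8]
        exact h3
      · have h6 : hκ.block (i + 1) = hκ.block i :=
          hκ.block_eq ((hκ.block_le i).trans (Nat.le_succ i)) h5
        simpa only [h6] using h3
    · rw [Filter.frequently_atTop] at h2 ⊢
      intro N
      obtain ⟨n, h3, h4⟩ := h2 N
      obtain ⟨i, h5, h6, h7⟩ := ha n h4
      refine ⟨i, h3.trans ((hκ.strictMono.le_apply).trans h5), ?_⟩
      simpa only [hκ.block_eq h5 h6] using h7

theorem NFA.respects_runType {α : Type u} {σ : Type v} (M : NFA α σ) :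
    Respects M.runType {x | BuchiAccepts M x} := by
  intro x y κ l hκ hl h hx
  obtain ⟨r, b, h0, h1, h2⟩ := (M.buchiAccepts_iff x hκ).1 hx
  exact (M.buchiAccepts_iff y hl).2 ⟨r, b, h0, fun n =>
    (Set.ext_iff.1 (h n) (r n, r (n + 1), b n)).1 (h1 n), h2⟩

/-! ### Equivalence relations of countable index -/

/-- `x` and `y` as one word of pairs. -/
def zipWord {α : Type u} {β : Type v} (x : ℕ → α) (y : ℕ → β) : ℕ → α × β := fun t => (x t, y t)

/-- The word which agrees with `b` on the blocks with number in `X` and with `a` on the others. -/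
noncomputable def mixWord {α : Type u} {κ : ℕ → ℕ} (hκ : IsCut κ) (a b : ℕ → α) (X : Set ℕ) :
    ℕ → α := by
  classical exact fun t => if hκ.block t ∈ X then b t else a t

theorem seg_zipWord_mixWord {α : Type u} {κ : ℕ → ℕ} (hκ : IsCut κ) (a b : ℕ → α) (X Y : Set ℕ)
    (x y : ℕ → α) (n : ℕ) (hx : (n ∈ X ∧ x = b) ∨ (n ∉ X ∧ x = a))
    (hy : (n ∈ Y ∧ y = b) ∨ (n ∉ Y ∧ y = a)) :
    seg (zipWord (mixWord hκ a b X) (mixWord hκ a b Y)) (κ n) (κ (n + 1)) =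
      seg (zipWord x y) (κ n) (κ (n + 1)) := by
  refine seg_congr fun i h1 h2 => ?_
  have h3 := hκ.block_eq h1 h2
  rcases hx with ⟨hx, rfl⟩ | ⟨hx, rfl⟩ <;> rcases hy with ⟨hy, rfl⟩ | ⟨hy, rfl⟩ <;>
    simp [zipWord, mixWord, h3, hx, hy]

section Sparse

variable {γ : Type u} {T : Type v} {Q : List γ → T} {κ : ℕ → ℕ} {p q : ℕ → γ} {e f : T}

/-- The hypothesis on `p` makes `e` idempotent: a segment of `p` of any positive number of blocks
has the class of a single block. -/
theorem class_eq_of_forall_notMem (hQ : IsCongr Q) (hκ : IsCut κ)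
    (hp : ∀ i j, 1 ≤ i → i < j → Q (seg p (κ i) (κ j)) = e) {z : ℕ → γ} {i j : ℕ} (hi : 1 ≤ i)
    (hij : i < j) (h : ∀ n, i ≤ n → n < j → Q (seg z (κ n) (κ (n + 1))) = e) :
    Q (seg z (κ i) (κ j)) = e := by
  induction j, hij using Nat.le_induction with
  | base => exact h i le_rfl (Nat.lt_succ_self i)
  | succ j hij ih =>
    have h1 := ih fun n h2 h3 => h n h2 (by omega)
    rw [← seg_append z (hκ.strictMono.monotone (show i ≤ j by omega)) (hκ.lt_succ j).le,
      ← hp i (j + 1) hi (by omega),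
      ← seg_append p (hκ.strictMono.monotone (show i ≤ j by omega)) (hκ.lt_succ j).le]
    exact hQ _ _ _ _ (h1.trans (hp _ _ hi hij).symm)
      ((h j (by omega) (by omega)).trans (hp _ _ (by omega) (by omega)).symm)

/-- Words which look like `p` everywhere except on a sparse sequence of blocks, where they look like
`q`, are indistinguishable. -/
theorem Respects.mem_of_sparse {L : Set (ℕ → γ)} (hQ : IsCongr Q) (hL : Respects Q L)
    (hκ : IsCut κ) (hp : ∀ i j, 1 ≤ i → i < j → Q (seg p (κ i) (κ j)) = e)
    (hq : Q (seg q (κ 1) (κ 2)) = f)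
    {z z' : ℕ → γ} {δ δ' : ℕ → ℕ} (hδ : ∀ i, δ i + 1 < δ (i + 1)) (hδ0 : 2 ≤ δ 0)
    (hδ' : ∀ i, δ' i + 1 < δ' (i + 1)) (hδ0' : 2 ≤ δ' 0)
    (h0 : Q (seg z (κ 0) (κ 1)) = Q (seg p (κ 0) (κ 1)))
    (h0' : Q (seg z' (κ 0) (κ 1)) = Q (seg p (κ 0) (κ 1)))
    (hf : ∀ i, Q (seg z (κ (δ i)) (κ (δ i + 1))) = f)
    (hf' : ∀ i, Q (seg z' (κ (δ' i)) (κ (δ' i + 1))) = f)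
    (he : ∀ n, 1 ≤ n → n ∉ Set.range δ → Q (seg z (κ n) (κ (n + 1))) = e)
    (he' : ∀ n, 1 ≤ n → n ∉ Set.range δ' → Q (seg z' (κ n) (κ (n + 1))) = e)
    (hz : z ∈ L) : z' ∈ L := by
  -- Regroup the blocks by cutting after each exceptional one. Because of the gaps, every group
  -- after the first is a nonempty run of class `e` followed by a block of class `f`, whatever `δ`
  -- is; the first group only has block `0` in front.
  have key : ∀ (z : ℕ → γ) (δ : ℕ → ℕ), (∀ i, δ i + 1 < δ (i + 1)) → 2 ≤ δ 0 →
      Q (seg z (κ 0) (κ 1)) = Q (seg p (κ 0) (κ 1)) →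
      (∀ i, Q (seg z (κ (δ i)) (κ (δ i + 1))) = f) →
      (∀ n, 1 ≤ n → n ∉ Set.range δ → Q (seg z (κ n) (κ (n + 1))) = e) →
      IsCut (fun n => if n = 0 then 0 else κ (δ (n - 1) + 1)) ∧
      ∀ n, Q (seg z (if n = 0 then 0 else κ (δ (n - 1) + 1))
        (if n + 1 = 0 then 0 else κ (δ (n + 1 - 1) + 1))) =
        if n = 0 then Q (seg p (κ 0) (κ 2) ++ seg q (κ 1) (κ 2))
          else Q (seg p (κ 1) (κ 2) ++ seg q (κ 1) (κ 2)) := by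
    intro z δ hδ hδ0 h0 hf he
    have hm : StrictMono δ := strictMono_nat_of_lt_succ fun i => (Nat.lt_succ_self _).trans (hδ i)
    refine ⟨⟨strictMono_nat_of_lt_succ fun n => ?_, by simp⟩, fun n => ?_⟩
    · rcases n with _ | n
      · simpa using (Nat.zero_le _).trans_lt (hκ.lt_succ (δ 0))
      · simpa using hκ.strictMono (show δ n + 1 < δ (n + 1) + 1 by have := hδ n; omega)
    · rcases n with _ | n
      · simp only [if_true, zero_add, one_ne_zero, if_false, Nat.sub_self]
        have hz0 : seg z 0 (κ (δ 0 + 1)) = seg z (κ 0) (κ (δ 0 + 1)) := by rw [hκ.zero]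
        rw [hz0, ← seg_append z (hκ.strictMono.monotone (Nat.zero_le (δ 0)))
          (hκ.lt_succ _).le]
        refine hQ _ _ _ _ ?_ ((hf 0).trans hq.symm)
        rw [← seg_append z (hκ.strictMono.monotone (Nat.zero_le 1))
          (hκ.strictMono.monotone (show 1 ≤ δ 0 by omega)),
          ← seg_append p (hκ.strictMono.monotone (Nat.zero_le 1)) (hκ.lt_succ 1).le]
        refine hQ _ _ _ _ h0 ?_
        rw [hp 1 2 le_rfl (by norm_num)]
        refine class_eq_of_forall_notMem hQ hκ hp le_rfl (by omega) fun n h1 h2 => he n h1 ?_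
        rintro ⟨i, rfl⟩
        have := hm.lt_iff_lt.1 h2
        omega
      · simp only [Nat.succ_ne_zero, if_false, Nat.add_sub_cancel]
        have := hδ n
        rw [← seg_append z (hκ.strictMono.monotone (show δ n + 1 ≤ δ (n + 1) by omega))
          (hκ.lt_succ _).le]
        refine hQ _ _ _ _ ?_ ((hf _).trans hq.symm)
        rw [hp 1 2 le_rfl (by norm_num)]
        refine class_eq_of_forall_notMem hQ hκ hp (by omega) this fun m h1 h2 =>
          he m (by omega) ?_
        rintro ⟨i, rfl⟩
        have h3 := hm.lt_iff_lt.1 h2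
        have h4 := hm.lt_iff_lt.1 (Nat.lt_of_succ_le h1)
        omega
  obtain ⟨hc, ht⟩ := key z δ hδ hδ0 h0 hf he
  obtain ⟨hc', ht'⟩ := key z' δ' hδ' hδ0' h0' hf' he'
  exact hL z z' _ _ hc hc' (fun n => (ht n).trans (ht' n).symm) hz

end Sparse

/-- An uncountable chain of sets of natural numbers with infinite differences. -/
theorem exists_chain_infinite_diff : ∃ X : ℝ → Set ℕ,
    (∀ r s, r ≤ s → X r ⊆ X s) ∧ ∀ r s, r < s → (X s \ X r).Infinite := by
  obtain ⟨q, hq⟩ := exists_surjective_nat ℚ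
  -- Dedekind cuts in an enumeration of the rationals.
  refine ⟨fun r => {n | (q n : ℝ) < r}, fun r s hrs n hn => lt_of_lt_of_le hn hrs, fun r s hrs => ?_⟩
  obtain ⟨c, hc1, hc2⟩ := exists_rat_btwn hrs
  obtain ⟨d, hd1, hd2⟩ := exists_rat_btwn hc2
  refine Set.Infinite.of_image q ((Set.Ioo_infinite (show c < d by exact_mod_cast hd1)).mono ?_)
  rintro x ⟨h1, h2⟩
  obtain ⟨n, rfl⟩ := hq x
  have h1' : (c : ℝ) < q n := by exact_mod_cast h1
  have h2' : (q n : ℝ) < d := by exact_mod_cast h2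
  exact ⟨n, ⟨h2'.trans hd2, not_lt.2 (hc1.trans h1').le⟩, rfl⟩

/-- Some word which is equivalent to `x` agrees with `c` up to finitely many positions. -/
def Covers {α : Type u} (E : (ℕ → α) → (ℕ → α) → Prop) (c x : ℕ → α) : Prop :=
  ∃ y, E x y ∧ ∀ᶠ t in Filter.atTop, y t = c t

/-! ### Finitely many words represent all classes up to finite modification. -/

section Index

variable {α : Type u} {T : Type v} {A : Type w} [Countable A] {Q : List (α × α) → T}
  {E : (ℕ → α) → (ℕ → α) → Prop} {D : Set (ℕ → α)} {F : (ℕ → α) → A}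

/-- Countability gives two equivalent mixtures of `a` and `b` that differ on an infinite sparse set
of blocks, where one has `a` and the other `b`. By `Respects.mem_of_sparse` every such sparse
replacement preserves equivalence. Two of them, on odd and then on even blocks, turn `a` into a word
that is `b` from block `2` on. -/
theorem covers_of_class_eq (hQ : IsCongr Q)
    (hL : Respects Q {z : ℕ → α × α | E (fun t => (z t).1) (fun t => (z t).2)})
    (hE : ∀ x y, E x y ↔ x ∈ D ∧ y ∈ D ∧ F x = F y) {κ : ℕ → ℕ} (hκ : IsCut κ) {a b : ℕ → α}
    (ha : a ∈ D) {e f : T} (haa : ∀ i j, 1 ≤ i → i < j → Q (seg (zipWord a a) (κ i) (κ j)) = e)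
    (hbb : ∀ i j, 1 ≤ i → i < j → Q (seg (zipWord b b) (κ i) (κ j)) = e)
    (hab : ∀ i j, 1 ≤ i → i < j → Q (seg (zipWord a b) (κ i) (κ j)) = f) : Covers E b a := by
  have hL' : ∀ x y, zipWord x y ∈ {z : ℕ → α × α | E (fun t => (z t).1) (fun t => (z t).2)} ↔
      E x y := fun x y => Iff.rfl
  let mix := mixWord hκ a b
  have hmix0 : mix ∅ = a := by funext t; simp [mix, mixWord]
  have heq : ∀ X Y n, n ≠ 0 → (n ∈ X ↔ n ∈ Y) →
      Q (seg (zipWord (mix X) (mix Y)) (κ n) (κ (n + 1))) = e := by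
    intro X Y n hn h
    by_cases hX : n ∈ X
    · rw [seg_zipWord_mixWord hκ a b X Y b b n (Or.inl ⟨hX, rfl⟩) (Or.inl ⟨h.1 hX, rfl⟩)]
      exact hbb _ _ (by omega) (by omega)
    · rw [seg_zipWord_mixWord hκ a b X Y a a n (Or.inr ⟨hX, rfl⟩)
        (Or.inr ⟨fun h' => hX (h.2 h'), rfl⟩)]
      exact haa _ _ (by omega) (by omega)
  have hne : ∀ X Y n, n ≠ 0 → n ∉ X → n ∈ Y →
      Q (seg (zipWord (mix X) (mix Y)) (κ n) (κ (n + 1))) = f := by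
    intro X Y n hn hX hY
    rw [seg_zipWord_mixWord hκ a b X Y a b n (Or.inr ⟨hX, rfl⟩) (Or.inl ⟨hY, rfl⟩)]
    exact hab _ _ (by omega) (by omega)
  have hzero : ∀ X Y, 0 ∉ X → 0 ∉ Y → Q (seg (zipWord (mix X) (mix Y)) (κ 0) (κ 1)) =
      Q (seg (zipWord a a) (κ 0) (κ 1)) := by
    intro X Y hX hY
    rw [seg_zipWord_mixWord hκ a b X Y a a 0 (Or.inr ⟨hX, rfl⟩) (Or.inr ⟨hY, rfl⟩)]
  have hD : ∀ X, 0 ∉ X → mix X ∈ D := by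
    intro X hX
    have h1 : E (mix X) (mix X) := by
      refine (hL' _ _).1 (hL (zipWord a a) _ κ κ hκ hκ (fun n => ?_) ((hL' a a).2
        ((hE _ _).2 ⟨ha, ha, rfl⟩)))
      rcases Nat.eq_zero_or_pos n with rfl | hn
      · exact (hzero X X hX hX).symm
      · rw [heq X X n hn.ne' Iff.rfl, haa _ _ hn (Nat.lt_succ_self n)]
    exact ((hE _ _).1 h1).1
  obtain ⟨C, hC, hCinf⟩ := exists_chain_infinite_diff
  -- Odd block numbers from `3` on: differences of these sets have no two neighbours and leave at
  -- least one block of class `e` after block `0`.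
  let X : ℝ → Set ℕ := fun r => (fun n => 2 * n + 3) '' C r
  have hX0 : ∀ r, 0 ∉ X r := by rintro r ⟨n, -, hn⟩; simp at hn
  obtain ⟨r, s, hrs, hF⟩ : ∃ r s, r < s ∧ F (mix (X r)) = F (mix (X s)) := by
    by_contra! hcon
    have hinj : Function.Injective fun r => F (mix (X r)) := fun r s hrs => by
      rcases lt_trichotomy r s with h | h | h
      · exact absurd hrs (hcon r s h)
      · exact h
      · exact absurd hrs.symm (hcon s r h)
    exact not_countable (α := ℝ) hinj.countable
  have hErs : E (mix (X r)) (mix (X s)) := (hE _ _).2 ⟨hD _ (hX0 r), hD _ (hX0 s), hF⟩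
  have := (hCinf r s hrs).to_subtype
  classical
  let g := Nat.orderEmbeddingOfSet (C s \ C r)
  have hg : Set.range g = C s \ C r := Nat.orderEmbeddingOfSet_range _
  have hgm : ∀ i, g i ∈ C s \ C r := fun i => hg ▸ ⟨i, rfl⟩
  -- The pair for `r` and `s`, whose exceptional blocks enumerate the difference of the two sets, is
  -- compared with an arbitrary sparse pair.
  have sparse : ∀ (δ : ℕ → ℕ) (Y Z : Set ℕ), (∀ i, δ i + 1 < δ (i + 1)) → 2 ≤ δ 0 → 0 ∉ Y → 0 ∉ Z →
      (∀ i, δ i ∉ Y ∧ δ i ∈ Z) → (∀ n, n ∉ Set.range δ → (n ∈ Y ↔ n ∈ Z)) →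
      E (mix Y) (mix Z) := by
    intro δ Y Z h1 h2 hY hZ h3 h4
    have h5 : ∀ i, δ i ≠ 0 := fun i => by
      rcases i with _ | i
      · omega
      · have := h1 i; omega
    refine (hL' _ _).1 (hL.mem_of_sparse hQ hκ haa (hab 1 2 le_rfl (by norm_num))
      (z := zipWord (mix (X r)) (mix (X s))) (δ := fun i => 2 * g i + 3)
      (fun i => ?_) (by simp) h1 h2 (hzero _ _ (hX0 r) (hX0 s)) (hzero _ _ hY hZ)
      (fun i => hne _ _ _ (by simp) ?_ ⟨g i, (hgm i).1, rfl⟩)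
      (fun i => hne _ _ _ (h5 i) (h3 i).1 (h3 i).2)
      (fun n hn hn' => heq _ _ _ (by omega) ⟨?_, ?_⟩)
      (fun n hn hn' => heq _ _ _ (by omega) (h4 n hn')) ((hL' _ _).2 hErs))
    · have : g i < g (i + 1) := g.strictMono (Nat.lt_succ_self i)
      omega
    · rintro ⟨m, hm, hm'⟩
      have : m = g i := by simpa using hm'
      exact (hgm i).2 (this ▸ hm)
    · rintro ⟨m, hm, rfl⟩
      exact ⟨m, hC r s hrs.le hm, rfl⟩
    · rintro ⟨m, hm, rfl⟩
      refine ⟨m, ?_, rfl⟩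
      by_contra hm'
      obtain ⟨i, hi⟩ : m ∈ Set.range g := hg ▸ ⟨hm, hm'⟩
      exact hn' ⟨i, by simp [hi]⟩
  -- Replace the odd blocks from `3` on; the even blocks from `2` on follow in `h2`.
  have h1 := sparse (fun i => 2 * i + 3) ∅ {n | 2 ≤ n ∧ n % 2 = 1} (fun i => by omega)
    (by norm_num) (by simp) (by simp)
    (fun i => ⟨by simp, ⟨by omega, by omega⟩⟩) (fun n hn => ⟨fun h => h.elim, fun h => ?_⟩)
  · have h2 := sparse (fun i => 2 * i + 2) {n | 2 ≤ n ∧ n % 2 = 1} {n | 2 ≤ n}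
      (fun i => by omega)
      (by norm_num) (by simp) (by simp)
      (fun i => ⟨fun h => by have := h.2; omega, show 2 ≤ _ by omega⟩)
      (fun n hn => ⟨fun h => h.1, fun h => ⟨h, ?_⟩⟩)
    · rw [hmix0] at h1
      have h3 := (hE _ _).1 h1
      have h4 := (hE _ _).1 h2
      refine ⟨mix {n | 2 ≤ n}, (hE _ _).2 ⟨h3.1, h4.2.1, h3.2.2.trans h4.2.2⟩, ?_⟩
      filter_upwards [Filter.eventually_ge_atTop (κ 2)] with t ht
      have h5 : 2 ≤ hκ.block t :=
        Nat.lt_succ_iff.1 (hκ.strictMono.lt_iff_lt.1 (ht.trans_lt (hκ.lt_block t)))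
      simp [mix, mixWord, h5]
    · by_contra hodd
      have hn2 : 2 ≤ n := h
      exact hn ⟨(n - 2) / 2, by dsimp only; omega⟩
  · obtain ⟨h3, h4⟩ := h
    exact hn ⟨(n - 3) / 2, by dsimp only; omega⟩

/-- One Ramsey factorisation serves all pairs of words at once, by colouring with the matrix of
their classes. Among more words than classes, two have the same diagonal entry, and
`covers_of_class_eq` applies to them. -/
theorem exists_covers_of_lt [Finite T] (hQ : IsCongr Q)
    (hL : Respects Q {z : ℕ → α × α | E (fun t => (z t).1) (fun t => (z t).2)})
    (hE : ∀ x y, E x y ↔ x ∈ D ∧ y ∈ D ∧ F x = F y) (x : Fin (Nat.card T + 1) → ℕ → α)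
    (hx : ∀ i, x i ∈ D) : ∃ i j, i < j ∧ Covers E (x i) (x j) := by
  obtain ⟨k, hk, c, hc⟩ := exists_strictMono_pairs_monochromatic
    fun m n => fun i j => Q (seg (zipWord (x i) (x j)) m n)
  have hc' : ∀ i j m n, 1 ≤ m → m < n → Q (seg (zipWord (x i) (x j))
      (if m = 0 then 0 else k m) (if n = 0 then 0 else k n)) = c i j := fun i j m n hm hn => by
    rw [if_neg (by omega), if_neg (by omega), ← hc m n hn]
  have := Fintype.ofFinite T
  obtain ⟨i, j, hij, he⟩ := Fintype.exists_ne_map_eq_of_card_lt (fun i => c i i) (by simp)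
  wlog hlt : i < j generalizing i j
  · exact this j i hij.symm he.symm (lt_of_le_of_ne (not_lt.1 hlt) hij.symm)
  exact ⟨i, j, hlt, covers_of_class_eq hQ hL hE (IsCut.of_strictMono hk) (hx j) (hc' j j)
    (by simpa [he] using hc' i i) (hc' j i)⟩

/-- Otherwise words could be picked greedily, none of them covered by an earlier one, until there
are too many for `exists_covers_of_lt`. -/
theorem exists_finite_cover [Finite T] (hQ : IsCongr Q)
    (hL : Respects Q {z : ℕ → α × α | E (fun t => (z t).1) (fun t => (z t).2)})
    (hE : ∀ x y, E x y ↔ x ∈ D ∧ y ∈ D ∧ F x = F y) (hne : D.Nonempty) :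
    ∃ c : Fin (Nat.card T) → ℕ → α, ∀ x ∈ D, ∃ i, Covers E (c i) x := by
  obtain ⟨d, -⟩ := hne
  by_contra! hcon
  have h : ∀ n ≤ Nat.card T + 1, ∃ l : List (ℕ → α), l.length = n ∧ (∀ x ∈ l, x ∈ D) ∧
      l.Pairwise fun x y => ¬ Covers E y x := by
    intro n hn
    induction n with
    | zero => exact ⟨[], rfl, by simp, List.Pairwise.nil⟩
    | succ n ih =>
      obtain ⟨l, h1, h2, h3⟩ := ih (by omega)
      -- The default `d` only fills the tuple up to its full length while the list is still short.
      obtain ⟨x, hx, hx'⟩ := hcon fun i => l.getD i d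
      refine ⟨x :: l, by simp [h1], by simpa [hx] using h2,
        List.pairwise_cons.2 ⟨fun y hy => ?_, h3⟩⟩
      obtain ⟨i, hi, rfl⟩ := List.getElem_of_mem hy
      have := hx' ⟨i, by omega⟩
      simpa [hi] using this
  obtain ⟨l, h1, h2, h3⟩ := h _ le_rfl
  have hrev : l.reverse.Pairwise fun x y => ¬ Covers E x y := List.pairwise_reverse.2 h3
  have hlen : l.reverse.length = Nat.card T + 1 := by simp [h1]
  obtain ⟨i, j, hij, hcov⟩ := exists_covers_of_lt hQ hL hE
    (fun i => l.reverse[(i : ℕ)]'(by have := i.2; omega))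
    (fun i => h2 _ (List.mem_reverse.1 (List.getElem_mem _)))
  exact List.pairwise_iff_getElem.1 hrev i j _ _ hij hcov

end Index

/-! ### Ultimately periodic representatives -/

/-- An automaton for the words over pairs `(x, c)` such that some word `y` which is related to `x`
by the automaton `M` agrees with one of the words `c i` up to finitely many positions. -/
def NFA.cover {α : Type u} {σ : Type v} (M : NFA (Fin 2 → α) σ) (K : ℕ) :
    NFA (α × (Fin K → α)) (σ × Option (Fin K)) where
  start := {s | s.1 ∈ M.start ∧ s.2 = none}
  step s a := {s' | ∃ b, s'.1 ∈ M.step s.1 ![a.1, b] ∧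
    (s.2 = none ∨ ∃ i, s.2 = some i ∧ s'.2 = some i ∧ b = a.2 i)}
  accept := {s | s.1 ∈ M.accept ∧ s.2 ≠ none}

/-- The automaton guesses `y` letter by letter. The second component of its state leaves `none` at
most once, to fix the index `i` from which agreement is then enforced; acceptance requires that it
does. -/
theorem NFA.buchiAccepts_cover_iff {α : Type u} {σ : Type v} (M : NFA (Fin 2 → α) σ) {K : ℕ}
    (x : ℕ → α) (c : ℕ → Fin K → α) : BuchiAccepts (M.cover K) (zipWord x c) ↔
      ∃ i, Covers (fun x y => BuchiAccepts M fun t => ![x t, y t]) (fun t => c t i) x := by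
  classical
  constructor
  · rintro ⟨ρ, h0, h1, h2⟩
    choose y hy hy' using h1
    obtain ⟨t₀, -, ht₀⟩ := (Filter.frequently_atTop.1 h2) 0
    obtain ⟨i, hi⟩ := Option.ne_none_iff_exists'.1 ht₀.2
    have h3 : ∀ t, t₀ ≤ t → (ρ t).2 = some i := by
      intro t ht
      induction t, ht using Nat.le_induction with
      | base => exact hi
      | succ t ht ih =>
        rcases hy' t with h | ⟨j, h4, h5, -⟩
        · simp [h] at ih
        · rw [h5, ← h4, ih]
    refine ⟨i, y, ⟨fun t => (ρ t).1, h0.1, hy, h2.mono fun t ht => ht.1⟩, ?_⟩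
    filter_upwards [Filter.eventually_ge_atTop t₀] with t ht
    rcases hy' t with h | ⟨j, h4, -, h6⟩
    · exact absurd (h3 t ht) (by simp [h])
    · rw [h3 t ht] at h4
      obtain rfl := Option.some.inj h4
      exact h6
  · rintro ⟨i, y, ⟨ρ, h0, h1, h2⟩, hy⟩
    obtain ⟨t₀, ht₀⟩ := Filter.eventually_atTop.1 hy
    refine ⟨fun t => (ρ t, if t ≤ t₀ then none else some i), ⟨h0, by simp⟩, fun t => ⟨y t, h1 t, ?_⟩,
      ?_⟩
    · by_cases ht : t ≤ t₀
      · simp [ht]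
      · exact Or.inr ⟨i, by simp [ht], by simp; omega, ht₀ t (by omega)⟩
    · refine (h2.and_eventually (Filter.eventually_gt_atTop t₀)).mono fun t ht => ⟨ht.1, ?_⟩
      simp [not_le.2 ht.2]

/-- A common multiple of periods of representatives, for an equivalence of countable
index which is given by an automaton with `n` states. -/
def periodBound (n : ℕ) : ℕ :=
  (2 ^ (2 ^ (n * (n * 2)) * 2 ^ (n * (2 ^ (n * (n * 2)) + 1) *
    (n * (2 ^ (n * (n * 2)) + 1) * 2)))).factorial

theorem Nat.card_set_eq_two_pow (β : Type v) [Finite β] : Nat.card (Set β) = 2 ^ Nat.card β := by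
  classical
  have := Fintype.ofFinite β
  simp [Nat.card_eq_fintype_card]

/-- The covering tuples are those for which no `x` satisfies both `E x x`, that is `x ∈ D`, and
failure to be covered. This is a complement of a projection, hence respects a finite congruence, and
`exists_finite_cover` makes it nonempty. A word ultimately equal to a component of a periodic
covering tuple is itself ultimately periodic. -/
theorem exists_equivalent_periodic {α : Type u} {σ : Type v} [Finite σ] {A : Type w} [Countable A]
    (M : NFA (Fin 2 → α) σ) {D : Set (ℕ → α)} {F : (ℕ → α) → A}
    (hE : ∀ x y, (BuchiAccepts M fun t => ![x t, y t]) ↔ x ∈ D ∧ y ∈ D ∧ F x = F y)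
    {x : ℕ → α} (hx : x ∈ D) : ∃ y ∈ D, F x = F y ∧
      ∃ m, ∀ t, m ≤ t → y (t + periodBound (Nat.card σ)) = y t := by
  have hQ : IsCongr fun l : List (α × α) => M.runType (l.map fun a => ![a.1, a.2]) :=
    M.isCongr_runType.comap _
  have hL := M.respects_runType.comap fun a : α × α => ![a.1, a.2]
  obtain ⟨K, hK, c, hc⟩ : ∃ K, K = Nat.card (Set (σ × σ × Bool)) ∧ ∃ c : Fin K → ℕ → α,
      ∀ x ∈ D, ∃ i, Covers (fun x y => BuchiAccepts M fun t => ![x t, y t]) (c i) x :=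
    ⟨_, rfl, exists_finite_cover hQ hL hE ⟨x, hx⟩⟩
  have hQ₃ := (M.isCongr_runType.comap fun a : α × (Fin K → α) => ![a.1, a.1]).prod
    (M.cover K).isCongr_runType
  have hL₃ := (M.respects_runType.comap fun a : α × (Fin K → α) => ![a.1, a.1]).inter
    (M.cover K).respects_runType.compl
  obtain ⟨z, hz, m, hm⟩ := hL₃.proj.compl.exists_periodic hQ₃.projClasses ⟨fun t i => c i t, by
    rintro ⟨y, h1, h2⟩
    exact h2 ((M.buchiAccepts_cover_iff y _).2 (hc y ((hE y y).1 h1).1))⟩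
  -- The exponential in front comes from the projection, the product from the intersection; the
  -- tuple has as many components as there are run types of `M`.
  have hcard : Nat.card (Set (Set (σ × σ × Bool) ×
      Set ((σ × Option (Fin K)) × (σ × Option (Fin K)) × Bool))) =
      2 ^ (2 ^ (Nat.card σ * (Nat.card σ * 2)) * 2 ^ (Nat.card σ *
        (2 ^ (Nat.card σ * (Nat.card σ * 2)) + 1) * (Nat.card σ *
          (2 ^ (Nat.card σ * (Nat.card σ * 2)) + 1) * 2))) := by
    simp [Nat.card_set_eq_two_pow, Nat.card_prod, hK]
  rw [hcard] at hm
  obtain ⟨i, y, hy, hy'⟩ : ∃ i, Covers (fun x y => BuchiAccepts M fun t => ![x t, y t])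
      (fun t => z t i) x := by
    rw [← M.buchiAccepts_cover_iff]
    by_contra hcon
    exact hz ⟨x, (hE x x).2 ⟨hx, hx, rfl⟩, hcon⟩
  obtain ⟨-, hyD, hF⟩ := (hE x y).1 hy
  obtain ⟨N, hN⟩ := Filter.eventually_atTop.1 hy'
  refine ⟨y, hyD, hF, max m N, fun t ht => ?_⟩
  rw [hN t (le_of_max_le_right ht), hN _ ((le_of_max_le_right ht).trans (Nat.le_add_right _ _))]
  exact congrFun (hm t (le_of_max_le_left ht)) i

/-! ### Automata given by lists of structured states -/

/-- A code for the automaton with states in `β` and the listed initial states, transitions and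
accepting states. -/
def AutomatonCode.ofLists {β : Type} [Encodable β] (init : List β) (trans : List (β × List ℕ × β))
    (accept : List β) : AutomatonCode where
  states := ((init.map Encodable.encode ++ trans.map fun t => Encodable.encode t.1) ++
    trans.map fun t => Encodable.encode t.2.2).foldr (fun a s => a + s + 1) 0
  init := init.map Encodable.encode
  trans := trans.map fun t => (Encodable.encode t.1, t.2.1, Encodable.encode t.2.2)
  accept := accept.map Encodable.encode

theorem List.lt_foldr_add_of_mem {l : List ℕ} {a : ℕ} (h : a ∈ l) :
    a < l.foldr (fun a s => a + s + 1) 0 := by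
  induction l with
  | nil => simp at h
  | cons b l ih =>
    rcases List.mem_cons.1 h with rfl | h
    · simp only [List.foldr_cons]; omega
    · have := ih h
      simp only [List.foldr_cons]; omega

theorem AutomatonCode.mem_rel_ofLists_iff {α : Type u} {β : Type} [Encodable β] {init : List β}
    {trans : List (β × List ℕ × β)} {accept : List β} (e : α → ℕ) (n : ℕ) (x : Fin n → ℕ → α) :
    x ∈ (AutomatonCode.ofLists init trans accept).rel e n ↔ ∃ ρ : ℕ → β, ρ 0 ∈ init ∧
      (∀ t, (ρ t, List.ofFn (fun j => e (x j t)), ρ (t + 1)) ∈ trans) ∧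
      ∃ᶠ t in Filter.atTop, ρ t ∈ accept := by
  constructor
  · rintro ⟨ρ, h0, h1, h2⟩
    have h3 : ∀ t, ∃ p q, (p, List.ofFn (fun j => e (x j t)), q) ∈ trans ∧
        Encodable.encode p = (ρ t : ℕ) ∧ Encodable.encode q = (ρ (t + 1) : ℕ) := fun t => by
      have h4 := h1 t
      simp only [AutomatonCode.toNFA, AutomatonCode.ofLists, convolution,
        List.mem_map, Prod.mk.injEq] at h4
      obtain ⟨⟨p, l, q⟩, h5, h6, rfl, h7⟩ := h4
      exact ⟨p, q, h5, h6, h7⟩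
    choose p q ht hp hq using h3
    have hpq : ∀ t, q t = p (t + 1) := fun t =>
      Encodable.encode_injective ((hq t).trans (hp (t + 1)).symm)
    refine ⟨p, ?_, fun t => hpq t ▸ ht t, h2.mono fun t h4 => ?_⟩
    · obtain ⟨s, hs, hs'⟩ := List.mem_map.1 h0
      exact Encodable.encode_injective (hs'.trans (hp 0).symm) ▸ hs
    · obtain ⟨s, hs, hs'⟩ := List.mem_map.1 h4
      exact Encodable.encode_injective (hs'.trans (hp t).symm) ▸ hs
  · rintro ⟨ρ, h0, h1, h2⟩
    refine ⟨fun t => ⟨Encodable.encode (ρ t), List.lt_foldr_add_of_mem ?_⟩,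
      List.mem_map.2 ⟨_, h0, rfl⟩, fun t => List.mem_map.2 ⟨_, h1 t, rfl⟩,
      h2.mono fun t h => List.mem_map.2 ⟨_, h, rfl⟩⟩
    -- Every state of an infinite run is the source of a transition, so its code is below the number
    -- of states.
    exact List.mem_append_left _ (List.mem_append_right _ (List.mem_map.2 ⟨_, h1 t, rfl⟩))

/-- A code may list numbers that are not states, so the bound stays as a condition on runs. It
reappears as the filter on transitions in `AutomatonCode.names`. -/
theorem AutomatonCode.mem_rel_iff {α : Type u} (c : AutomatonCode) (e : α → ℕ) (n : ℕ)
    (x : Fin n → ℕ → α) : x ∈ c.rel e n ↔ ∃ ρ : ℕ → ℕ, ρ 0 ∈ c.init ∧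
      (∀ t, ρ t < c.states ∧ (ρ t, List.ofFn (fun j => e (x j t)), ρ (t + 1)) ∈ c.trans) ∧
      ∃ᶠ t in Filter.atTop, ρ t ∈ c.accept := by
  constructor
  · rintro ⟨ρ, h0, h1, h2⟩
    exact ⟨fun t => ρ t, h0, fun t => ⟨(ρ t).2, h1 t⟩, h2⟩
  · rintro ⟨ρ, h0, h1, h2⟩
    exact ⟨fun t => ⟨ρ t, (h1 t).1⟩, h0, fun t => (h1 t).2, h2⟩

theorem List.mem_sections_ofFn {β : Type u} {n : ℕ} {L : Fin n → List β} {s : List β} :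
    s ∈ (List.ofFn L).sections ↔ ∃ g : Fin n → β, s = List.ofFn g ∧ ∀ j, g j ∈ L j := by
  rw [List.mem_sections]
  constructor
  · intro h
    have hl := h.length_eq
    rw [List.length_ofFn] at hl
    subst hl
    refine ⟨s.get, (List.ofFn_get s).symm, fun j => ?_⟩
    have := (List.forall₂_iff_get.1 h).2 j j.2 (by simp)
    simpa using this
  · rintro ⟨g, rfl, hg⟩
    exact List.forall₂_iff_get.2 ⟨by simp, fun i h1 h2 => by simpa using hg _⟩

/-! ### Finite words as names of ultimately periodic words -/

/-- `x'` is the padding of a finite word `w`, and `x` extends `w` with period `M`, where `w`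
is thought to be preceded by the letters with number `0`. -/
def IsName {k : ℕ} (M : ℕ) (x' : ℕ → Option (Fin k)) (x : ℕ → Fin k) : Prop :=
  x' ∈ Set.range padding ∧ ∀ t, (∀ a, x' t = some a → x t = a) ∧
    (x' t = none → (x t : ℕ) = if M ≤ t then (x (t - M) : ℕ) else 0)

/-- The words of length `M` over the letters less than `k`. -/
def wordsOfLength (k M : ℕ) : List (List ℕ) := (List.replicate M (List.range k)).sections

/-- The transitions of a transducer from names to words, as tuples of the old state, the letter
read, the letter written and the new state.  A state consists of the last `M` letters written and
of a flag, which tells whether the end of the finite word has been read. -/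
def tapeTransitions (k M : ℕ) :
    List ((List ℕ × Bool) × ℕ × ℕ × (List ℕ × Bool)) :=
  ((wordsOfLength k M).flatMap fun b => (List.range k).map fun a =>
    ((b, false), a + 1, a, (b.tail ++ [a], false))) ++
  ((wordsOfLength k M).flatMap fun b => [false, true].map fun m =>
    ((b, m), 0, b.headI, (b.tail ++ [b.headI], true)))

/-- An automaton for the names of the tuples of words which are accepted by `c`. -/
def AutomatonCode.names (k M n : ℕ) (c : AutomatonCode) : AutomatonCode :=
  AutomatonCode.ofLists
    (c.init.map fun q => (q, List.replicate n (List.replicate M 0, false)))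
    ((c.trans.filter fun t => t.1 < c.states).flatMap fun t =>
      (t.2.1.map fun a => (tapeTransitions k M).filter fun τ => τ.2.2.1 = a).sections.map fun ts =>
        ((t.1, ts.map fun τ => τ.1), ts.map (fun τ => τ.2.1), (t.2.2, ts.map fun τ => τ.2.2.2)))
    (c.accept.flatMap fun q =>
      ((List.replicate n ((wordsOfLength k M).map fun b => (b, true))).sections.map fun s => (q, s)))

/-! ### Correctness of the automaton that reads names. -/

theorem mem_wordsOfLength {k M : ℕ} {s : List ℕ} :
    s ∈ wordsOfLength k M ↔ ∃ g : Fin M → ℕ, s = List.ofFn g ∧ ∀ i, g i < k := by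
  rw [wordsOfLength, ← List.ofFn_const, List.mem_sections_ofFn]
  simp

theorem mem_tapeTransitions {k M : ℕ} {b b' : List ℕ} {m m' : Bool} {i o : ℕ} :
    ((b, m), i, o, (b', m')) ∈ tapeTransitions k M ↔ b ∈ wordsOfLength k M ∧
      b' = b.tail ++ [o] ∧ ((m = false ∧ m' = false ∧ i = o + 1 ∧ o < k) ∨
        (m' = true ∧ i = 0 ∧ o = b.headI)) := by
  simp only [tapeTransitions, List.mem_append, List.mem_flatMap, List.mem_map, List.mem_range,
    Prod.mk.injEq]
  constructor
  · rintro (⟨b, hb, a, ha, ⟨rfl, rfl⟩, rfl, rfl, rfl, rfl⟩ |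
      ⟨b, hb, a, ha, ⟨rfl, rfl⟩, rfl, rfl, rfl, rfl⟩)
    · exact ⟨hb, rfl, Or.inl ⟨rfl, rfl, rfl, ha⟩⟩
    · exact ⟨hb, rfl, Or.inr ⟨rfl, rfl, rfl⟩⟩
  · rintro ⟨hb, rfl, ⟨rfl, rfl, rfl, ha⟩ | ⟨rfl, rfl, rfl⟩⟩
    · exact Or.inl ⟨b, hb, o, ha, ⟨rfl, rfl⟩, rfl, rfl, rfl, rfl⟩
    · exact Or.inr ⟨b, hb, m, by simp, ⟨rfl, rfl⟩, rfl, rfl, rfl, rfl⟩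

/-- The last `M` letters of `y` before the position `t`, preceded by zeros. -/
def buffer (M : ℕ) (y : ℕ → ℕ) (t : ℕ) : List ℕ :=
  List.ofFn fun r : Fin M => if M ≤ t + r then y (t + r - M) else 0

theorem buffer_zero (M : ℕ) (y : ℕ → ℕ) : buffer M y 0 = List.replicate M 0 := by
  rw [buffer, ← List.ofFn_const]
  congr 1
  funext r
  simp

theorem headI_buffer {M : ℕ} (hM : 0 < M) (y : ℕ → ℕ) (t : ℕ) :
    (buffer M y t).headI = if M ≤ t then y (t - M) else 0 := by
  obtain ⟨m, rfl⟩ := Nat.exists_eq_succ_of_ne_zero hM.ne'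
  simp [buffer, List.ofFn_succ]

theorem buffer_succ {M : ℕ} (hM : 0 < M) (y : ℕ → ℕ) (t : ℕ) :
    buffer M y (t + 1) = (buffer M y t).tail ++ [y t] := by
  obtain ⟨m, rfl⟩ := Nat.exists_eq_succ_of_ne_zero hM.ne'
  rw [buffer, List.ofFn_succ', List.concat_eq_append]
  congr 1
  · rw [buffer, List.ofFn_succ, List.tail_cons]
    congr 1
    funext r
    simp only [Fin.val_castSucc, Fin.val_succ, show t + 1 + (r : ℕ) = t + (r + 1) by omega]
  · simp [show t + 1 + m = t + (m + 1) by omega]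

theorem padding_none_succ {α : Type u} {x : ℕ → Option α} (hx : x ∈ Set.range padding) {t : ℕ}
    (h : x t = none) : x (t + 1) = none := by
  obtain ⟨w, rfl⟩ := hx
  simp only [padding, List.getElem?_eq_none_iff] at h ⊢
  omega

theorem mem_range_padding {α : Type u} {x : ℕ → Option α} (h : ∀ t, x t = none → x (t + 1) = none)
    {N : ℕ} (hN : x N = none) : x ∈ Set.range padding := by
  classical
  have hex : ∃ n, x n = none := ⟨N, hN⟩
  have hsome : ∀ i : Fin (Nat.find hex), ∃ a, x i = some a := fun i =>
    Option.ne_none_iff_exists'.1 (Nat.find_min hex i.2)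
  choose w hw using hsome
  refine ⟨List.ofFn w, funext fun t => ?_⟩
  rw [padding]
  by_cases ht : t < Nat.find hex
  · simp [ht, hw ⟨t, ht⟩]
  · rw [List.getElem?_eq_none (by simpa using ht)]
    have : ∀ t, Nat.find hex ≤ t → x t = none := fun t ht => by
      induction t, ht using Nat.le_induction with
      | base => exact Nat.find_spec hex
      | succ t _ ih => exact h t ih
    exact (this t (not_lt.1 ht)).symm

theorem eventually_padding_none {α : Type u} {x : ℕ → Option α} (hx : x ∈ Set.range padding) :
    ∀ᶠ t in Filter.atTop, x t = none := by
  obtain ⟨w, rfl⟩ := hx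
  filter_upwards [Filter.eventually_ge_atTop w.length] with t ht
  exact List.getElem?_eq_none ht

theorem paddedLetter_eq_zero {k : ℕ} {a : Option (Fin k)} : paddedLetter k a = 0 ↔ a = none := by
  cases a <;> simp [paddedLetter]

theorem AutomatonCode.mem_names_trans_iff {k M n : ℕ} {c : AutomatonCode} {p q : ℕ}
    {s s' : List (List ℕ × Bool)} {i : Fin n → ℕ} :
    ((p, s), List.ofFn i, (q, s')) ∈ ((c.trans.filter fun t => t.1 < c.states).flatMap fun t =>
      (t.2.1.map fun a => (tapeTransitions k M).filter fun τ => τ.2.2.1 = a).sections.map fun ts =>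
        ((t.1, ts.map fun τ => τ.1), ts.map (fun τ => τ.2.1), (t.2.2, ts.map fun τ => τ.2.2.2))) ↔
    ∃ (b b' : Fin n → List ℕ × Bool) (o : Fin n → ℕ), s = List.ofFn b ∧ s' = List.ofFn b' ∧
      p < c.states ∧ (p, List.ofFn o, q) ∈ c.trans ∧
      ∀ j, (b j, i j, o j, b' j) ∈ tapeTransitions k M := by
  simp only [List.mem_flatMap, List.mem_filter, List.mem_map, decide_eq_true_eq, Prod.mk.injEq]
  constructor
  · rintro ⟨⟨p, l, q⟩, ⟨ht, hp⟩, ts, hts, ⟨rfl, rfl⟩, hi, rfl, rfl⟩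
    -- A listed label may have any length; comparison with the `n` letters read forces `n' = n`.
    obtain ⟨n', o, rfl⟩ : ∃ n', ∃ o : Fin n' → ℕ, l = List.ofFn o :=
      ⟨_, l.get, (List.ofFn_get l).symm⟩
    rw [List.map_ofFn, List.mem_sections_ofFn] at hts
    obtain ⟨g, rfl, hg⟩ := hts
    rw [List.map_ofFn] at hi
    have hn := congrArg List.length hi
    simp only [List.length_ofFn] at hn
    subst hn
    have hi' := List.ofFn_injective hi
    refine ⟨fun j => (g j).1, fun j => (g j).2.2.2, o, by simp [Function.comp_def],
      by simp [Function.comp_def], hp, ht, fun j => ?_⟩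
    have h1 := hg j
    simp only [Function.comp_apply, List.mem_filter, decide_eq_true_eq] at h1
    rw [← hi', ← h1.2]
    exact h1.1
  · rintro ⟨b, b', o, rfl, rfl, hp, ht, h⟩
    refine ⟨(p, List.ofFn o, q), ⟨ht, hp⟩, List.ofFn fun j => (b j, i j, o j, b' j), ?_,
      by simp [Function.comp_def]⟩
    rw [List.map_ofFn, List.mem_sections_ofFn]
    exact ⟨_, rfl, fun j => by simpa using h j⟩

/-- In a run, the word component on each tape is the buffer of the last `M` letters written, so its
head is the letter demanded by periodic continuation. The flag, once set, permits only blanks, and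
acceptance needs it on all tapes; hence each tape carries a padded finite word. -/
theorem AutomatonCode.mem_rel_names_iff {k M n : ℕ} (hM : 0 < M) (c : AutomatonCode)
    (x' : Fin n → ℕ → Option (Fin k)) :
    x' ∈ (c.names k M n).rel (paddedLetter k) n ↔
      ∃ x : Fin n → ℕ → Fin k, (∀ j, IsName M (x' j) (x j)) ∧ x ∈ c.rel Fin.val n := by
  rw [AutomatonCode.names, AutomatonCode.mem_rel_ofLists_iff]
  constructor
  · rintro ⟨ρ, h0, h1, h2⟩
    have h1' : ∀ t, ∃ (b b' : Fin n → List ℕ × Bool) (o : Fin n → ℕ), (ρ t).2 = List.ofFn b ∧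
        (ρ (t + 1)).2 = List.ofFn b' ∧ (ρ t).1 < c.states ∧
        ((ρ t).1, List.ofFn o, (ρ (t + 1)).1) ∈ c.trans ∧
        ∀ j, (b j, paddedLetter k (x' j t), o j, b' j) ∈ tapeTransitions k M := fun t =>
      AutomatonCode.mem_names_trans_iff.1 (h1 t)
    choose b b' o hb hb' hp ht hτ using h1'
    have hbb : ∀ t, b' t = b (t + 1) := fun t =>
      List.ofFn_injective ((hb' t).symm.trans (hb (t + 1)))
    obtain ⟨q₀, hq₀, hρ₀⟩ := List.mem_map.1 h0
    have hb0 : ∀ j, b 0 j = (List.replicate M 0, false) := fun j => by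
      have h3 := hb 0
      rw [← hρ₀, ← List.ofFn_const] at h3
      exact (congrFun (List.ofFn_injective h3) j).symm
    have hτ' : ∀ t j, (b t j).1 ∈ wordsOfLength k M ∧ (b (t + 1) j).1 = (b t j).1.tail ++ [o t j] ∧
        (((b t j).2 = false ∧ (b (t + 1) j).2 = false ∧ paddedLetter k (x' j t) = o t j + 1 ∧
          o t j < k) ∨ ((b (t + 1) j).2 = true ∧ paddedLetter k (x' j t) = 0 ∧
          o t j = (b t j).1.headI)) := fun t j => by
      rw [← hbb]
      exact mem_tapeTransitions.1 (hτ t j)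
    have hbuf : ∀ j t, (b t j).1 = buffer M (fun t => o t j) t := fun j t => by
      induction t with
      | zero => rw [buffer_zero, hb0]
      | succ t ih => rw [buffer_succ hM, (hτ' t j).2.1, ih]
    have hlt : ∀ t j, o t j < k := fun t j => by
      obtain ⟨h3, -, h4 | h4⟩ := hτ' t j
      · exact h4.2.2.2
      · rw [h4.2.2]
        obtain ⟨g, hg, hg'⟩ := mem_wordsOfLength.1 h3
        obtain ⟨m, rfl⟩ := Nat.exists_eq_succ_of_ne_zero hM.ne'
        rw [hg, List.ofFn_succ]
        exact hg' 0
    refine ⟨fun j t => ⟨o t j, hlt t j⟩, fun j => ⟨?_, fun t => ⟨fun a ha => ?_, fun hn => ?_⟩⟩,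
      (AutomatonCode.mem_rel_iff _ _ _ _).2 ⟨fun t => (ρ t).1, ?_, fun t => ⟨hp t, ht t⟩,
        h2.mono fun t h3 => ?_⟩⟩
    · have hmode : ∀ t, x' j t = none → (b (t + 1) j).2 = true := fun t h3 => by
        rcases (hτ' t j).2.2 with h4 | h4
        · rw [h3] at h4
          exact absurd h4.2.2.1 (by simp [paddedLetter])
        · exact h4.1
      -- Taking `N ≥ 1` provides a transition into the accepting state; the flag set there shows
      -- that letter `N - 1` is blank.
      obtain ⟨N, hN, hN'⟩ := Filter.frequently_atTop.1 h2 1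
      refine mem_range_padding (N := N - 1) (fun t h3 => ?_) ?_
      · rcases (hτ' (t + 1) j).2.2 with h4 | h4
        · rw [hmode t h3] at h4
          exact absurd h4.1 (by simp)
        · exact paddedLetter_eq_zero.1 h4.2.1
      · simp only [List.mem_flatMap, List.mem_map] at hN'
        obtain ⟨q, -, s, hs, hρ⟩ := hN'
        rw [← List.ofFn_const, List.mem_sections_ofFn] at hs
        obtain ⟨g, rfl, hg⟩ := hs
        have h3 := hb N
        rw [← hρ] at h3
        have h4 := congrFun (List.ofFn_injective h3) j
        obtain ⟨w, -, hw⟩ := List.mem_map.1 (hg j)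
        rcases (hτ' (N - 1) j).2.2 with h5 | h5
        · rw [Nat.sub_add_cancel hN, ← h4, ← hw] at h5
          exact absurd h5.2.1 (by simp)
        · exact paddedLetter_eq_zero.1 h5.2.1
    · rcases (hτ' t j).2.2 with h4 | h4
      · rw [ha] at h4
        exact Fin.ext (by simpa [paddedLetter] using h4.2.2.1.symm)
      · rw [ha] at h4
        exact absurd h4.2.1 (by simp [paddedLetter])
    · rcases (hτ' t j).2.2 with h4 | h4
      · rw [hn] at h4
        exact absurd h4.2.2.1 (by simp [paddedLetter])
      · rw [hbuf, headI_buffer hM] at h4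
        exact h4.2.2
    · simpa only [← hρ₀] using hq₀
    · simp only [List.mem_flatMap, List.mem_map] at h3
      obtain ⟨q, hq, s, -, hρ⟩ := h3
      simpa only [← hρ] using hq
  · rintro ⟨x, hx, hacc⟩
    obtain ⟨ρ, h0, h1, h2⟩ := (AutomatonCode.mem_rel_iff _ _ _ _).1 hacc
    -- The flag before position `t` records whether the preceding letter was blank; nothing has been
    -- read at `t = 0`.
    let m : Fin n → ℕ → Bool := fun j t => decide (0 < t ∧ x' j (t - 1) = none)
    have hw : ∀ j t, buffer M (fun t => x j t) t ∈ wordsOfLength k M := fun j t =>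
      mem_wordsOfLength.2 ⟨_, rfl, fun i => by
        have := (x j 0).2
        split_ifs
        · exact Fin.is_lt _
        · omega⟩
    refine ⟨fun t => (ρ t, List.ofFn fun j => (buffer M (fun t => x j t) t, m j t)),
      List.mem_map.2 ⟨ρ 0, h0, ?_⟩, fun t => AutomatonCode.mem_names_trans_iff.2
        ⟨_, _, fun j => x j t, rfl, rfl, (h1 t).1, (h1 t).2, fun j => mem_tapeTransitions.2
          ⟨hw j t, buffer_succ hM _ t, ?_⟩⟩, ?_⟩
    · rw [← List.ofFn_const]
      simp [buffer_zero, m]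
    · rcases hxt : x' j t with _ | a
      · refine Or.inr ⟨by simp [m, hxt], by simp [paddedLetter], ?_⟩
        rw [headI_buffer hM]
        exact ((hx j).2 t).2 hxt
      · refine Or.inl ⟨?_, by simp [m, hxt], by simp [paddedLetter, ((hx j).2 t).1 a hxt],
          Fin.is_lt _⟩
        refine decide_eq_false fun h3 => ?_
        have h4 := padding_none_succ (hx j).1 h3.2
        rw [Nat.sub_add_cancel h3.1, hxt] at h4
        simp at h4
    · have h3 : ∀ᶠ t in Filter.atTop, ∀ j, m j t = true := by
        refine Filter.eventually_all.2 fun j => ?_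
        obtain ⟨N, hN⟩ := Filter.eventually_atTop.1 (eventually_padding_none (hx j).1)
        filter_upwards [Filter.eventually_gt_atTop N] with t ht
        exact decide_eq_true ⟨by omega, hN _ (by omega)⟩
      refine (h2.and_eventually h3).mono fun t ht => ?_
      simp only [List.mem_flatMap, List.mem_map]
      refine ⟨ρ t, ht.1, _, ?_, rfl⟩
      rw [← List.ofFn_const, List.mem_sections_ofFn]
      exact ⟨_, rfl, fun j => List.mem_map.2 ⟨_, hw j t, by simp [ht.2 j]⟩⟩

/-! ### Computability of the constructions -/

theorem Primrec.nat_pow : Primrec₂ ((· ^ ·) : ℕ → ℕ → ℕ) :=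
  Primrec₂.unpaired'.1 Nat.Primrec.pow

theorem Primrec.nat_factorial : Primrec Nat.factorial := by
  refine (Primrec.nat_rec₁ (f := fun n s => (n + 1) * s) 1 ?_).of_eq fun n => ?_
  · exact Primrec.nat_mul.comp (Primrec.succ.comp Primrec.fst) Primrec.snd
  · induction n with
    | zero => rfl
    | succ n ih => simp only [Nat.factorial_succ, ← ih]

/-- The algorithm needs no search for periods: an explicit function of the number of states serves
all elements at once. -/
theorem primrec_periodBound : Primrec periodBound := by
  have h2 : Primrec fun n : ℕ => 2 ^ (n * (n * 2)) :=
    Primrec.nat_pow.comp (Primrec.const 2) (Primrec.nat_mul.comp Primrec.id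
      (Primrec.nat_mul.comp Primrec.id (Primrec.const 2)))
  have h3 : Primrec fun n : ℕ => n * (2 ^ (n * (n * 2)) + 1) :=
    Primrec.nat_mul.comp Primrec.id (Primrec.succ.comp h2)
  exact Primrec.nat_factorial.comp (Primrec.nat_pow.comp (Primrec.const 2)
    (Primrec.nat_mul.comp (Primrec.nat_pow.comp (Primrec.const 2)
      (Primrec.nat_mul.comp Primrec.id (Primrec.nat_mul.comp Primrec.id (Primrec.const 2))))
      (Primrec.nat_pow.comp (Primrec.const 2)
        (Primrec.nat_mul.comp h3 (Primrec.nat_mul.comp h3 (Primrec.const 2))))))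

theorem Primrec.list_sections {α : Type u} [Primcodable α] :
    Primrec (List.sections : List (List α) → List (List α)) := by
  refine (Primrec.list_foldr (h := fun _ p => p.2.flatMap fun s => p.1.map fun a => a :: s)
    Primrec.id (Primrec.const [[]]) ?_).of_eq fun L => ?_
  · refine Primrec.list_flatMap (Primrec.snd.comp Primrec.snd) (Primrec.list_map
      (Primrec.fst.comp (Primrec.snd.comp Primrec.fst)) ?_)
    exact Primrec.list_cons.comp Primrec.snd (Primrec.snd.comp Primrec.fst)
  · induction L with
    | nil => rfl
    | cons l L ih =>
      simp only [id, List.foldr_cons, List.sections] at ih ⊢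
      rw [ih]

theorem Primrec.list_replicate {α : Type u} [Primcodable α] :
    Primrec₂ (List.replicate : ℕ → α → List α) := by
  refine (Primrec.list_map (f := fun p : ℕ × α => List.range p.1) (g := fun p _ => p.2)
    (Primrec.list_range.comp Primrec.fst) (Primrec.snd.comp Primrec.fst)).of_eq fun p => ?_
  simp [List.map_const']

theorem primrec_automatonCode_equivProd : Primrec AutomatonCode.equivProd :=
  @Primrec.of_equiv _ _ _ AutomatonCode.equivProd

theorem primrec_automatonCode_equivProd_symm : Primrec AutomatonCode.equivProd.symm :=
  @Primrec.of_equiv_symm _ _ _ AutomatonCode.equivProd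

theorem primrec_automatonCode_states : Primrec AutomatonCode.states :=
  Primrec.fst.comp primrec_automatonCode_equivProd

theorem primrec_automatonCode_init : Primrec AutomatonCode.init :=
  Primrec.fst.comp (Primrec.snd.comp primrec_automatonCode_equivProd)

theorem primrec_automatonCode_trans : Primrec AutomatonCode.trans :=
  Primrec.fst.comp (Primrec.snd.comp (Primrec.snd.comp
    primrec_automatonCode_equivProd))

theorem primrec_automatonCode_accept : Primrec AutomatonCode.accept :=
  Primrec.snd.comp (Primrec.snd.comp (Primrec.snd.comp
    primrec_automatonCode_equivProd))

theorem primrec_automatonCode_mk {α : Type u} [Primcodable α] {s : α → ℕ} {i a : α → List ℕ}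
    {t : α → List (ℕ × List ℕ × ℕ)} (hs : Primrec s) (hi : Primrec i) (ht : Primrec t)
    (ha : Primrec a) : Primrec fun x => (⟨s x, i x, t x, a x⟩ : AutomatonCode) :=
  primrec_automatonCode_equivProd_symm.comp
    (hs.pair (hi.pair (ht.pair ha)))

theorem primrec_ofLists {α : Type u} [Primcodable α] {β : Type} [Primcodable β] {i a : α → List β}
    {t : α → List (β × List ℕ × β)} (hi : Primrec i) (ht : Primrec t) (ha : Primrec a) :
    Primrec fun x => AutomatonCode.ofLists (i x) (t x) (a x) := by
  have henc : ∀ {f : α → List β}, Primrec f → Primrec fun x => (f x).map Encodable.encode :=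
    fun hf => Primrec.list_map hf (Primrec.encode.comp Primrec.snd)
  refine primrec_automatonCode_mk (Primrec.list_foldr (h := fun _ p => p.1 + p.2 + 1)
    (Primrec.list_append.comp (Primrec.list_append.comp (henc hi) ?_) ?_) (Primrec.const 0) ?_)
    (henc hi) ?_ (henc ha)
  · exact Primrec.list_map ht (Primrec.encode.comp (Primrec.fst.comp Primrec.snd))
  · exact Primrec.list_map ht (Primrec.encode.comp (Primrec.snd.comp (Primrec.snd.comp Primrec.snd)))
  · exact Primrec.succ.comp (Primrec.nat_add.comp (Primrec.fst.comp Primrec.snd)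
      (Primrec.snd.comp Primrec.snd))
  · exact Primrec.list_map ht (Primrec.pair (Primrec.encode.comp (Primrec.fst.comp Primrec.snd))
      (Primrec.pair (Primrec.fst.comp (Primrec.snd.comp Primrec.snd))
        (Primrec.encode.comp (Primrec.snd.comp (Primrec.snd.comp Primrec.snd)))))

theorem primrec_wordsOfLength : Primrec₂ wordsOfLength :=
  Primrec.list_sections.comp (Primrec.list_replicate.comp Primrec.snd
    (Primrec.list_range.comp Primrec.fst))

theorem primrec_tapeTransitions : Primrec₂ tapeTransitions := by
  have hrot : ∀ {α : Type} [Primcodable α] {f : α → List ℕ} {g : α → ℕ}, Primrec f → Primrec g →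
      Primrec fun x => (f x).tail ++ [g x] := fun hf hg =>
    Primrec.list_concat.comp (Primrec.list_tail.comp hf) hg
  refine Primrec.list_append.comp
    (Primrec.list_flatMap primrec_wordsOfLength (Primrec.list_map
      (Primrec.list_range.comp (Primrec.fst.comp Primrec.fst)) ?_))
    (Primrec.list_flatMap primrec_wordsOfLength (Primrec.list_map (Primrec.const _) ?_))
  · have hb : Primrec fun x : ((ℕ × ℕ) × List ℕ) × ℕ => x.1.2 := Primrec.snd.comp Primrec.fst
    exact (hb.pair (Primrec.const false)).pair ((Primrec.succ.comp Primrec.snd).pair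
      (Primrec.snd.pair ((hrot hb Primrec.snd).pair (Primrec.const false))))
  · have hb : Primrec fun x : ((ℕ × ℕ) × List ℕ) × Bool => x.1.2 := Primrec.snd.comp Primrec.fst
    have hh := Primrec.list_headI.comp hb
    exact (hb.pair Primrec.snd).pair ((Primrec.const 0).pair
      (hh.pair ((hrot hb hh).pair (Primrec.const true))))

theorem primrec_names {α : Type u} [Primcodable α] {k M n : α → ℕ} {c : α → AutomatonCode}
    (hk : Primrec k) (hM : Primrec M) (hn : Primrec n) (hc : Primrec c) :
    Primrec fun x => (c x).names (k x) (M x) (n x) := by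
  refine primrec_ofLists (Primrec.list_map (primrec_automatonCode_init.comp hc) ?_)
    (Primrec.list_flatMap ?_ (Primrec.list_map (Primrec.list_sections.comp
      (Primrec.list_map (Primrec.fst.comp (Primrec.snd.comp Primrec.snd)) ?_)) ?_))
    (Primrec.list_flatMap (primrec_automatonCode_accept.comp hc) (Primrec.list_map
      (Primrec.list_sections.comp (Primrec.list_replicate.comp (hn.comp Primrec.fst)
        (Primrec.list_map (primrec_wordsOfLength.comp (hk.comp Primrec.fst)
          (hM.comp Primrec.fst)) ?_))) ?_))
  · exact Primrec.snd.pair (Primrec.list_replicate.comp (hn.comp Primrec.fst)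
      ((Primrec.list_replicate.comp (hM.comp Primrec.fst) (Primrec.const 0)).pair
        (Primrec.const false)))
  · have h : PrimrecRel fun (t : ℕ × List ℕ × ℕ) (s : ℕ) => t.1 < s :=
      Primrec.nat_lt.comp₂ (Primrec.fst.comp Primrec.fst) Primrec.snd
    exact h.listFilter.comp (primrec_automatonCode_trans.comp hc)
      (primrec_automatonCode_states.comp hc)
  · have h : PrimrecRel fun (τ : (List ℕ × Bool) × ℕ × ℕ × (List ℕ × Bool)) (a : ℕ) =>
        τ.2.2.1 = a :=
      Primrec.eq.comp₂ (Primrec.fst.comp (Primrec.snd.comp (Primrec.snd.comp Primrec.fst)))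
        Primrec.snd
    exact h.listFilter.comp (primrec_tapeTransitions.comp (hk.comp (Primrec.fst.comp Primrec.fst))
      (hM.comp (Primrec.fst.comp Primrec.fst))) Primrec.snd
  · have hm : ∀ {β : Type} [Primcodable β] {f : (List ℕ × Bool) × ℕ × ℕ × (List ℕ × Bool) → β},
        Primrec f → Primrec fun x : (α × (ℕ × List ℕ × ℕ)) ×
          List ((List ℕ × Bool) × ℕ × ℕ × (List ℕ × Bool)) => x.2.map f := fun hf =>
      Primrec.list_map Primrec.snd (hf.comp Primrec.snd)
    have ht : Primrec fun x : (α × (ℕ × List ℕ × ℕ)) ×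
        List ((List ℕ × Bool) × ℕ × ℕ × (List ℕ × Bool)) => x.1.2 :=
      Primrec.snd.comp Primrec.fst
    exact ((Primrec.fst.comp ht).pair (hm Primrec.fst)).pair
      ((hm (Primrec.fst.comp Primrec.snd)).pair
        ((Primrec.snd.comp (Primrec.snd.comp ht)).pair
          (hm (Primrec.snd.comp (Primrec.snd.comp Primrec.snd)))))
  · exact Primrec.snd.pair (Primrec.const true)
  · exact (Primrec.snd.comp Primrec.fst).pair Primrec.snd

/-- The presentation by names of ultimately periodic words. -/
def PresentationCode.names (c : PresentationCode) : PresentationCode where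
  alphabet := c.alphabet
  dom := c.dom.names c.alphabet (periodBound c.equiv.states) 1
  equiv := c.equiv.names c.alphabet (periodBound c.equiv.states) 2
  rels := c.rels.map fun r => (r.1, r.2.names c.alphabet (periodBound c.equiv.states) r.1)

/-- The presentation over the letters `□, 0, …, k - 1`, now numbered `0, …, k`. -/
def PresentationCode.succAlphabet (c : PresentationCode) : PresentationCode where
  alphabet := c.alphabet + 1
  dom := c.dom
  equiv := c.equiv
  rels := c.rels

theorem primrec_presentationCode_equivProd : Primrec PresentationCode.equivProd :=
  @Primrec.of_equiv _ _ _ PresentationCode.equivProd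

theorem primrec_presentationCode_equivProd_symm : Primrec PresentationCode.equivProd.symm :=
  @Primrec.of_equiv_symm _ _ _ PresentationCode.equivProd

theorem primrec_presentationCode_alphabet : Primrec PresentationCode.alphabet := by
  have h := Primrec.fst.comp primrec_presentationCode_equivProd
  exact h

theorem primrec_presentationCode_dom : Primrec PresentationCode.dom := by
  have h := Primrec.fst.comp (Primrec.snd.comp primrec_presentationCode_equivProd)
  exact h

theorem primrec_presentationCode_equiv : Primrec PresentationCode.equiv := by
  have h := Primrec.fst.comp (Primrec.snd.comp (Primrec.snd.comp primrec_presentationCode_equivProd))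
  exact h

theorem primrec_presentationCode_rels : Primrec PresentationCode.rels := by
  have h := Primrec.snd.comp (Primrec.snd.comp (Primrec.snd.comp primrec_presentationCode_equivProd))
  exact h

theorem primrec_presentationCode_mk {α : Type u} [Primcodable α] {k : α → ℕ}
    {d e : α → AutomatonCode} {r : α → List (ℕ × AutomatonCode)} (hk : Primrec k) (hd : Primrec d)
    (he : Primrec e) (hr : Primrec r) :
    Primrec fun x => (⟨k x, d x, e x, r x⟩ : PresentationCode) := by
  have h := primrec_presentationCode_equivProd_symm.comp (hk.pair (hd.pair (he.pair hr)))
  exact h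

theorem primrec_presentationCode_names : Primrec PresentationCode.names := by
  have hM : Primrec fun c : PresentationCode => periodBound c.equiv.states :=
    primrec_periodBound.comp (primrec_automatonCode_states.comp primrec_presentationCode_equiv)
  have hk := primrec_presentationCode_alphabet
  refine primrec_presentationCode_mk hk (primrec_names hk hM (Primrec.const 1)
    primrec_presentationCode_dom) (primrec_names hk hM (Primrec.const 2)
    primrec_presentationCode_equiv) (Primrec.list_map primrec_presentationCode_rels ?_)
  exact (Primrec.fst.comp Primrec.snd).pair (primrec_names (hk.comp Primrec.fst)
    (hM.comp Primrec.fst) (Primrec.fst.comp Primrec.snd) (Primrec.snd.comp Primrec.snd))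

theorem primrec_presentationCode_succAlphabet : Primrec PresentationCode.succAlphabet :=
  primrec_presentationCode_mk (Primrec.succ.comp primrec_presentationCode_alphabet)
    primrec_presentationCode_dom primrec_presentationCode_equiv primrec_presentationCode_rels

/-! ### Changing the names in a presentation -/

/-- If every element has a name whose new names are given by the functional relation `G`, then the
preimages under `G` form a presentation. -/
theorem IsPresentation.exists_preimage {A : Type u} {ι : Type v} {ar : ι → ℕ} {α β : Type w}
    {R : ∀ i, Set (Fin (ar i) → A)} {D : Set (Fin 1 → ℕ → α)} {E : Set (Fin 2 → ℕ → α)}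
    {S : ∀ i, Set (Fin (ar i) → ℕ → α)} {f : {x : ℕ → α // (fun _ => x) ∈ D} → A}
    (h : IsPresentation R D E S f) (G : (ℕ → β) → (ℕ → α) → Prop)
    (hG : ∀ x' x y, G x' x → G x' y → x = y)
    (hsurj : ∀ x, ∃ x' y, G x' y ∧ ∃ hy, f ⟨y, hy⟩ = f x)
    {D' : Set (Fin 1 → ℕ → β)} {E' : Set (Fin 2 → ℕ → β)} {S' : ∀ i, Set (Fin (ar i) → ℕ → β)}
    (hD : ∀ x', x' ∈ D' ↔ ∃ x, (∀ j, G (x' j) (x j)) ∧ x ∈ D)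
    (hE : ∀ x', x' ∈ E' ↔ ∃ x, (∀ j, G (x' j) (x j)) ∧ x ∈ E)
    (hS : ∀ i x', x' ∈ S' i ↔ ∃ x, (∀ j, G (x' j) (x j)) ∧ x ∈ S i) :
    ∃ f' : {x : ℕ → β // (fun _ => x) ∈ D'} → A, IsPresentation R D' E' S' f' := by
  have hD₁ : ∀ x' : ℕ → β, (fun _ => x') ∈ D' ↔ ∃ x, G x' x ∧ (fun _ => x) ∈ D := by
    intro x'
    rw [hD]
    constructor
    · rintro ⟨x, h1, h2⟩
      refine ⟨x 0, h1 0, ?_⟩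
      convert h2 using 1
      funext j
      rw [Subsingleton.elim j 0]
    · rintro ⟨x, h1, h2⟩
      exact ⟨fun _ => x, fun _ => h1, h2⟩
  choose g hg hgD using fun x' : {x : ℕ → β // (fun _ => x) ∈ D'} => (hD₁ x'.1).1 x'.2
  let f' : {x : ℕ → β // (fun _ => x) ∈ D'} → A := fun x' => f ⟨g x', hgD x'⟩
  have hf' : ∀ x' x (hx' : (fun _ => x') ∈ D') (hx : (fun _ => x) ∈ D), G x' x →
      f' ⟨x', hx'⟩ = f ⟨x, hx⟩ := by
    intro x' x hx' hx hxx
    have : g ⟨x', hx'⟩ = x := hG _ _ _ (hg _) hxx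
    simp only [f', this]
  refine ⟨f', fun a => ?_, fun x' => ?_, fun i x' => ?_⟩
  · obtain ⟨x, rfl⟩ := h.surjective a
    obtain ⟨x', y, h1, hy, h2⟩ := hsurj x
    exact ⟨⟨x', (hD₁ x').2 ⟨y, h1, hy⟩⟩, (hf' _ _ _ _ h1).trans h2⟩
  · rw [hE]
    constructor
    · rintro ⟨x, h1, h2⟩
      obtain ⟨h3, h4⟩ := (h.mem_equiv_iff x).1 h2
      refine ⟨fun j => (hD₁ _).2 ⟨x j, h1 j, h3 j⟩, ?_⟩
      rw [hf' _ _ _ (h3 0) (h1 0), hf' _ _ _ (h3 1) (h1 1), h4]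
    · rintro ⟨h1, h2⟩
      exact ⟨fun j => g ⟨x' j, h1 j⟩, fun j => hg ⟨x' j, h1 j⟩,
        (h.mem_equiv_iff _).2 ⟨fun j => hgD _, h2⟩⟩
  · rw [hS]
    constructor
    · rintro ⟨x, h1, h2⟩
      obtain ⟨h3, h4⟩ := (h.mem_rel_iff i x).1 h2
      refine ⟨fun j => (hD₁ _).2 ⟨x j, h1 j, h3 j⟩, ?_⟩
      simpa only [fun j => hf' _ _ ((hD₁ _).2 ⟨x j, h1 j, h3 j⟩) (h3 j) (h1 j)] using h4
    · rintro ⟨h1, h2⟩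
      exact ⟨fun j => g ⟨x' j, h1 j⟩, fun j => hg ⟨x' j, h1 j⟩,
        (h.mem_rel_iff i _).2 ⟨fun j => hgD _, h2⟩⟩

/-! ### Every element has a finite word as a name. -/

theorem periodBound_pos (n : ℕ) : 0 < periodBound n := Nat.factorial_pos _

/-- Each letter is either given by the finite word or copied from a strictly earlier position, as
`M` is positive. -/
theorem IsName.eq {k M : ℕ} (hM : 0 < M) {x' : ℕ → Option (Fin k)} {x y : ℕ → Fin k}
    (hx : IsName M x' x) (hy : IsName M x' y) : x = y := by
  funext t
  induction t using Nat.strong_induction_on with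
  | _ t ih =>
    rcases h : x' t with _ | a
    · have h1 := (hx.2 t).2 h
      have h2 := (hy.2 t).2 h
      refine Fin.ext (h1.trans (Eq.trans ?_ h2.symm))
      split_ifs with ht
      · rw [ih _ (by omega)]
      · rfl
    · rw [(hx.2 t).1 a h, (hy.2 t).1 a h]

theorem exists_isName {k M m : ℕ} {x : ℕ → Fin k} (h : ∀ t, m ≤ t → x (t + M) = x t) :
    ∃ x', IsName M x' x := by
  -- With a prefix of length `m + M`, the position copied at any blank is at least `m`, where
  -- periodicity already holds.
  refine ⟨padding (List.ofFn fun i : Fin (m + M) => x i), ⟨_, rfl⟩, fun t => ⟨fun a ha => ?_,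
    fun hn => ?_⟩⟩
  · rw [padding] at ha
    obtain ⟨h1, h2⟩ := List.getElem?_eq_some_iff.1 ha
    simpa using h2
  · rw [padding, List.getElem?_eq_none_iff, List.length_ofFn] at hn
    rw [if_pos (by omega), ← h (t - M) (by omega), Nat.sub_add_cancel (by omega)]

theorem IsPresentation.exists_periodic {A : Type u} [Countable A] {ι : Type v} {ar : ι → ℕ}
    {α : Type w} {R : ∀ i, Set (Fin (ar i) → A)} {D : Set (Fin 1 → ℕ → α)}
    {E : Set (Fin 2 → ℕ → α)} {S : ∀ i, Set (Fin (ar i) → ℕ → α)}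
    {f : {x : ℕ → α // (fun _ => x) ∈ D} → A} (h : IsPresentation R D E S f) {σ : Type} [Finite σ]
    (M : NFA (Fin 2 → α) σ) (hM : recognizedRel M = E) (x : {x : ℕ → α // (fun _ => x) ∈ D}) :
    ∃ y, f y = f x ∧ ∃ m, ∀ t, m ≤ t → y.1 (t + periodBound (Nat.card σ)) = y.1 t := by
  classical
  -- Extending `f` by `none` makes it total with a countable codomain.
  let F : (ℕ → α) → Option A := fun x =>
    if hx : (fun _ => x) ∈ D then some (f ⟨x, hx⟩) else none
  have hF : ∀ (x) (hx : (fun _ => x) ∈ D), F x = some (f ⟨x, hx⟩) := fun x hx => dif_pos hx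
  obtain ⟨y, hy, h1, h2⟩ := exists_equivalent_periodic (D := {x | (fun _ => x) ∈ D}) (F := F) M
    (fun x y => by
      have hconv : (fun t => ![x t, y t]) = convolution ![x, y] := by
        funext t j
        fin_cases j <;> rfl
      have h3 : BuchiAccepts M (convolution ![x, y]) ↔ ![x, y] ∈ E := by rw [← hM]; rfl
      rw [hconv, h3, h.mem_equiv_iff]
      constructor
      · rintro ⟨h4, h5⟩
        have hx : (fun _ => x) ∈ D := h4 0
        have hy : (fun _ => y) ∈ D := h4 1
        refine ⟨hx, hy, ?_⟩
        rw [hF x hx, hF y hy]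
        exact congrArg some h5
      · rintro ⟨hx, hy, h4⟩
        rw [hF x hx, hF y hy] at h4
        refine ⟨fun j => ?_, Option.some.inj h4⟩
        fin_cases j
        · exact hx
        · exact hy) x.2
  refine ⟨⟨y, hy⟩, ?_, h2⟩
  rw [hF _ x.2, hF _ hy] at h1
  exact (Option.some.inj h1).symm

theorem AutomatonCode.exists_presentation_names {A : Type u} [Countable A] {ι : Type v}
    {ar : ι → ℕ} {R : ∀ i, Set (Fin (ar i) → A)} {k : ℕ} (d e : AutomatonCode)
    (B : ι → AutomatonCode) {f : {x : ℕ → Fin k // (fun _ => x) ∈ d.rel Fin.val 1} → A}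
    (h : IsPresentation R (d.rel Fin.val 1) (e.rel Fin.val 2)
      (fun i => (B i).rel Fin.val (ar i)) f) :
    (∀ x ∈ (d.names k (periodBound e.states) 1).rel (paddedLetter k) 1,
      x 0 ∈ Set.range padding) ∧
    ∃ f', IsPresentation R ((d.names k (periodBound e.states) 1).rel (paddedLetter k) 1)
      ((e.names k (periodBound e.states) 2).rel (paddedLetter k) 2)
      (fun i => ((B i).names k (periodBound e.states) (ar i)).rel (paddedLetter k) (ar i)) f' := by
  have hM := periodBound_pos e.states
  refine ⟨fun x hx => ?_, h.exists_preimage (IsName (periodBound e.states))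
    (fun _ _ _ => IsName.eq hM) (fun x => ?_) (AutomatonCode.mem_rel_names_iff hM d)
    (AutomatonCode.mem_rel_names_iff hM e) fun i => AutomatonCode.mem_rel_names_iff hM (B i)⟩
  · obtain ⟨y, hy, -⟩ := (AutomatonCode.mem_rel_names_iff hM d x).1 hx
    exact (hy 0).1
  · obtain ⟨y, h1, m, h2⟩ := h.exists_periodic (e.toNFA Fin.val 2) rfl x
    rw [Nat.card_fin] at h2
    obtain ⟨x', hx'⟩ := exists_isName h2
    exact ⟨x', y.1, hx', y.2, h1⟩

/-- With finitely many states, letters and tapes there are only finitely many transitions to list.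
Effectiveness is not needed here, since the equivalence of the two notions also concerns infinitely
many relations. -/
theorem IsOmegaRegular.exists_code {α : Type u} {n k : ℕ} {S : Set (Fin n → ℕ → α)}
    (hS : IsOmegaRegular S) (φ : Fin k → α) :
    ∃ c : AutomatonCode, ∀ x, x ∈ c.rel Fin.val n ↔ (fun j t => φ (x j t)) ∈ S := by
  obtain ⟨σ, _, M, rfl⟩ := hS
  have := Encodable.ofCountable σ
  let t : Set (σ × List ℕ × σ) :=
    (fun s : σ × (Fin n → Fin k) × σ => (s.1, List.ofFn (fun j => (s.2.1 j : ℕ)), s.2.2)) ''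
      {s | s.2.2 ∈ M.step s.1 fun j => φ (s.2.1 j)}
  have ht : t.Finite := (Set.toFinite _).image _
  have hmem : ∀ p (a : Fin n → Fin k) q, (p, List.ofFn (fun j => (a j : ℕ)), q) ∈ t ↔
      q ∈ M.step p fun j => φ (a j) := by
    intro p a q
    constructor
    · rintro ⟨⟨p', a', q'⟩, h1, h2⟩
      simp only [Prod.mk.injEq] at h2
      obtain ⟨rfl, h3, rfl⟩ := h2
      have h4 : a' = a := funext fun j => Fin.ext (congrFun (List.ofFn_injective h3) j)
      exact h4 ▸ h1
    · exact fun h => ⟨(p, a, q), h, rfl⟩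
  refine ⟨AutomatonCode.ofLists (Set.toFinite M.start).toFinset.toList ht.toFinset.toList
    (Set.toFinite M.accept).toFinset.toList, fun x => ?_⟩
  rw [AutomatonCode.mem_rel_ofLists_iff]
  simp only [Finset.mem_toList, Set.Finite.mem_toFinset]
  refine exists_congr fun ρ => and_congr Iff.rfl (and_congr (forall_congr' fun i => ?_) Iff.rfl)
  exact hmem _ (fun j => x j i) _

theorem AutomatonCode.isOmegaRegular_rel {α : Type u} (c : AutomatonCode) (e : α → ℕ) (n : ℕ) :
    IsOmegaRegular (c.rel e n) :=
  ⟨_, inferInstance, c.toNFA e n, rfl⟩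

/-! ### The two directions, for structures and for codes. -/

theorem IsOmegaAutomatic.isAutomatic {A : Type u} [Countable A] {ι : Type v} {ar : ι → ℕ}
    {R : ∀ i, Set (Fin (ar i) → A)} (h : IsOmegaAutomatic R) : IsAutomatic R := by
  obtain ⟨α, _, D, E, S, f, hD, hE, hS, h⟩ := h
  obtain ⟨k, ⟨φ⟩⟩ := Finite.exists_equiv_fin α
  obtain ⟨d, hd⟩ := hD.exists_code φ.symm
  obtain ⟨e, he⟩ := hE.exists_code φ.symm
  choose B hB using fun i => (hS i).exists_code φ.symm
  have hpre : ∀ {n : ℕ} (x' : Fin n → ℕ → Fin k) (S : Set (Fin n → ℕ → α)),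
      (fun j t => φ.symm (x' j t)) ∈ S ↔
        ∃ x : Fin n → ℕ → α, (∀ j, x j = fun t => φ.symm (x' j t)) ∧ x ∈ S := fun x' S =>
    ⟨fun h => ⟨_, fun _ => rfl, h⟩, fun ⟨x, h1, h2⟩ => (funext h1 : x = _) ▸ h2⟩
  obtain ⟨f₁, h₁⟩ := h.exists_preimage (fun x' x => x = fun t => φ.symm (x' t))
    (fun _ _ _ h1 h2 => h1.trans h2.symm)
    (fun x => ⟨fun t => φ (x.1 t), x.1, by simp, x.2, rfl⟩)
    (fun x' => (hd x').trans (hpre x' D)) (fun x' => (he x').trans (hpre x' E))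
    (fun i x' => (hB i x').trans (hpre x' (S i)))
  obtain ⟨hpad, f', h'⟩ := AutomatonCode.exists_presentation_names d e B h₁
  exact ⟨Fin k, inferInstance, _, _, _, f', AutomatonCode.isOmegaRegular_rel _ _ _,
    AutomatonCode.isOmegaRegular_rel _ _ _, fun _ => AutomatonCode.isOmegaRegular_rel _ _ _,
    hpad, h'⟩

theorem IsAutomatic.isOmegaAutomatic {A : Type u} {ι : Type v} {ar : ι → ℕ}
    {R : ∀ i, Set (Fin (ar i) → A)} (h : IsAutomatic R) : IsOmegaAutomatic R := by
  obtain ⟨α, _, D, E, S, f, hD, hE, hS, -, h⟩ := h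
  exact ⟨Option α, inferInstance, D, E, S, f, hD, hE, hS, h⟩

theorem PresentationCode.OmegaPresents.names {A : Type u} [Countable A] {m : ℕ} {ar : Fin m → ℕ}
    {R : ∀ i, Set (Fin (ar i) → A)} {c : PresentationCode} (h : c.OmegaPresents R) :
    c.names.Presents R := by
  obtain ⟨B, hB, f, h⟩ := h
  obtain ⟨hpad, f', h'⟩ := AutomatonCode.exists_presentation_names c.dom c.equiv B h
  exact ⟨fun i => (B i).names c.alphabet (periodBound c.equiv.states) (ar i),
    by simp [PresentationCode.names, hB, List.map_ofFn, Function.comp_def], hpad, f', h'⟩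

theorem PresentationCode.Presents.succAlphabet {A : Type u} {m : ℕ} {ar : Fin m → ℕ}
    {R : ∀ i, Set (Fin (ar i) → A)} {c : PresentationCode} (h : c.Presents R) :
    c.succAlphabet.OmegaPresents R := by
  obtain ⟨B, hB, -, f, h⟩ := h
  -- With the blank as letter `0`, the numbering `paddedLetter` becomes `Fin.val`, so the automata
  -- are kept unchanged.
  let θ : Fin (c.alphabet + 1) → Option (Fin c.alphabet) := Fin.cases none some
  have hθ : ∀ a, paddedLetter c.alphabet (θ a) = a := fun a => by
    refine Fin.cases ?_ (fun a => ?_) a <;> simp [θ, paddedLetter]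
  have hθ' : Function.Surjective θ := fun a => by
    rcases a with _ | a
    · exact ⟨0, rfl⟩
    · exact ⟨a.succ, rfl⟩
  have hpre : ∀ (d : AutomatonCode) {n : ℕ} (x' : Fin n → ℕ → Fin (c.alphabet + 1)),
      x' ∈ d.rel Fin.val n ↔ ∃ x : Fin n → ℕ → Option (Fin c.alphabet),
        (∀ j, x j = fun t => θ (x' j t)) ∧ x ∈ d.rel (paddedLetter c.alphabet) n := by
    intro d n x'
    have h1 : x' ∈ d.rel Fin.val n ↔
        (fun j t => θ (x' j t)) ∈ d.rel (paddedLetter c.alphabet) n := by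
      simp only [AutomatonCode.mem_rel_iff, hθ]
    rw [h1]
    exact ⟨fun h => ⟨_, fun _ => rfl, h⟩, fun ⟨x, h1, h2⟩ => (funext h1 : x = _) ▸ h2⟩
  obtain ⟨f', h'⟩ := h.exists_preimage (fun x' x => x = fun t => θ (x' t))
    (fun _ _ _ h1 h2 => h1.trans h2.symm)
    (fun x => by
      choose y hy using fun t => hθ' (x.1 t)
      exact ⟨y, x.1, funext fun t => (hy t).symm, x.2, rfl⟩)
    (hpre c.dom) (hpre c.equiv) (fun i => hpre (B i))
  exact ⟨B, hB, f', h'⟩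

theorem corollary2 :
    (∀ (A : Type u) [Countable A] (ι : Type v) (ar : ι → ℕ) (R : ∀ i, Set (Fin (ar i) → A)),
      IsOmegaAutomatic R ↔ IsAutomatic R) ∧
    (∃ F : PresentationCode →. PresentationCode, Partrec F ∧
      ∀ (A : Type u) [Countable A] (m : ℕ) (ar : Fin m → ℕ) (R : ∀ i, Set (Fin (ar i) → A))
        (c : PresentationCode), c.OmegaPresents R → ∃ d ∈ F c, d.Presents R) ∧
    (∃ G : PresentationCode →. PresentationCode, Partrec G ∧
      ∀ (A : Type u) [Countable A] (m : ℕ) (ar : Fin m → ℕ) (R : ∀ i, Set (Fin (ar i) → A))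
        (c : PresentationCode), c.Presents R → ∃ d ∈ G c, d.OmegaPresents R) :=
  ⟨fun _ _ _ _ _ => ⟨IsOmegaAutomatic.isAutomatic, IsAutomatic.isOmegaAutomatic⟩,
    ⟨_, primrec_presentationCode_names.to_comp.partrec,
      fun _ _ _ _ _ c h => ⟨c.names, Part.mem_some _, h.names⟩⟩,
    ⟨_, primrec_presentationCode_succAlphabet.to_comp.partrec,
      fun _ _ _ _ _ c h => ⟨c.succAlphabet, Part.mem_some _, h.succAlphabet⟩⟩⟩
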